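/- Let $R, A, B$ be (nonzero) finite-dimensional quantum systems, $\mathcal N_0\neq\mathcal N_1$ quantum channels (completely positive trace-preserving maps) from $A$ to $B$. For a state $\rho$ on $RA$ write $\mathcal N_i(\rho)=(\mathrm{id}_R\otimes\mathcal N_i)(\rho)$, and for a POVM $m=\{m_y\}_{y\in\mathcal Y}$ on $RB$ with finite alphabet $\mathcal Y$ let $P_{\mathcal N_i,\rho,m}(y)=\mathrm{Tr}[\mathcal N_i(\rho)m_y]$. Assume that $$\max_{i=0,1} D_{\max}(\mathcal N_i\|\mathcal N_{1-i})<\infty,\qquad D_{\max}(\mathcal N_i\|\mathcal N_{1-i})=\sup_{\rho^{RA}}\inf\{\gamma\in\mathbb R:\mathcal N_i(\rho^{RA})\le 2^\gamma\,\mathcal N_{1-i}(\rho^{RA})\}.$$ A *non-adaptive sequential strategy* consists of a finite alphabet $\mathcal Y$, probability measures $\nu_1,\nu_2,\dots$ on pairs (state on $RA$, POVM on $RB$ with outcomes in $\mathcal Y$), and measurable decision functions $d_k$ with values in $\{0,1,*\}$. In round $k$ a pair $(\rho_k,m_k)$ is drawn from $\nu_k$, independently of all other rounds, the unknown channel is applied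 to $\rho_k$, and $m_k$ is measured on the output with outcome $Y_k$; then $d_k$ is applied to $(\rho_j,m_j,Y_j)_{j\le k}$. The value $*$ means that the experiment continues, and $T\in\mathbb N\cup\{\infty\}$ is the first $k\ge1$ with $d_k\ne *$, at which the experimenter stops and accepts hypothesis $H_{d_T}$. For a sequence of strategies $(\mathcal S_n)$ let $\mathbb P_{n,i},\mathbb E_{n,i}$ be probability and expectation under $\mathcal S_n$ when the channel is $\mathcal N_i$, and let $\alpha_n=\mathbb P_{n,0}(T_n<\infty,d_{T_n}=1)$, $\beta_n=\mathbb P_{n,1}(T_n<\infty,d_{T_n}=0)$. Let $\mathcal R_{\mathrm E}$ be the set of pairs $(R_0,R_1)$ with $R_0,R_1\ge0$ for which there is a sequence $(\mathcal S_n)$ of non-adaptive strategies with $\alpha_n\to0$, $\beta_n\to0$, $$\liminf_{n\to\infty}\tfrac1n\log\tfrac1{\alpha_n}\ge R_0,\qquad \liminf_{n\to\infty}\tfrac1n\log\tfrac1{\beta_n}\ge R_1,\qquad \limsup_{n\to\infty}\Big(\max_{i\in\{0,1\}}\mathbb E_{n,i}[T_n]-n\Big)\le 0,$$ and, for $0<\varepsilon<1$,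 let $\mathcal R_{\mathrm P}(\varepsilon)$ be defined in the same way with the last condition replaced by $\limsup_{n\to\infty}\max_{i\in\{0,1\}}\mathbb P_{n,i}(T_n>n)<\varepsilon$. Then for every $0<\varepsilon<1$ $$\mathcal R_{\mathrm E}=\mathcal R_{\mathrm P}(\varepsilon)=\overline{\mathrm{Conv}(\mathcal C)},\qquad \mathcal C=\bigcup_{\rho,\mathcal Y,m}\Big\{(R_0,R_1): 0\le R_0\le D(P_{\mathcal N_1,\rho,m}\|P_{\mathcal N_0,\rho,m}),\ 0\le R_1\le D(P_{\mathcal N_0,\rho,m}\|P_{\mathcal N_1,\rho,m})\Big\},$$ where $\rho$ runs over all states on $RA$, $\mathcal Y$ over all finite sets, $m$ over all POVMs on $RB$ with outcomes in $\mathcal Y$, $D$ is the classical relative entropy (natural logarithm, as for the exponents), and $\overline{\mathrm{Conv}(\cdot)}$ is the closure of the convex hull. -/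

import Mathlib

open MeasureTheory Filter
open scoped ENNReal ComplexOrder

noncomputable section

namespace ChannelDisc

variable {R A B H : Type*}

/-! ### States, channels and POVMs -/

/-- Density operators on the system `H`. -/
def State (H : Type*) [Fintype H] : Type _ :=
  {ρ : Matrix H H ℂ // ρ.PosSemidef ∧ ρ.trace = 1}

instance [Fintype H] : TopologicalSpace (State H) := instTopologicalSpaceSubtype
instance [Fintype H] : MeasurableSpace (State H) := borel _
instance [Fintype H] : BorelSpace (State H) := ⟨rfl⟩

/-- POVMs on the system `H` with outcomes in the alphabet `{0, …, q - 1}`. -/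
def POVM (H : Type*) [Fintype H] [DecidableEq H] (q : ℕ) : Type _ :=
  {m : Fin q → Matrix H H ℂ // (∀ y, (m y).PosSemidef) ∧ ∑ y, m y = 1}

instance [Fintype H] [DecidableEq H] (q : ℕ) : TopologicalSpace (POVM H q) :=
  instTopologicalSpaceSubtype
instance [Fintype H] [DecidableEq H] (q : ℕ) : MeasurableSpace (POVM H q) := borel _
instance [Fintype H] [DecidableEq H] (q : ℕ) : BorelSpace (POVM H q) := ⟨rfl⟩

/-- The linear map `id_R ⊗ N`, acting block by block: for `X = ∑ |r⟩⟨r'| ⊗ X_{r r'}` it returns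
`∑ |r⟩⟨r'| ⊗ N (X_{r r'})`. -/
def ampl (R : Type*) (N : Matrix A A ℂ →ₗ[ℂ] Matrix B B ℂ) :
    Matrix (R × A) (R × A) ℂ →ₗ[ℂ] Matrix (R × B) (R × B) ℂ where
  toFun X := Matrix.of fun x y => N (Matrix.of fun a a' => X (x.1, a) (y.1, a')) x.2 y.2
  map_add' X Y := by
    ext x y
    have h : (Matrix.of fun a a' => (X + Y) (x.1, a) (y.1, a')) =
        (Matrix.of fun a a' => X (x.1, a) (y.1, a')) +
          Matrix.of fun a a' => Y (x.1, a) (y.1, a') := rfl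
    change N _ x.2 y.2 = N _ x.2 y.2 + N _ x.2 y.2
    rw [h, map_add, Matrix.add_apply]
  map_smul' c X := by
    ext x y
    have h : (Matrix.of fun a a' => (c • X) (x.1, a) (y.1, a')) =
        c • Matrix.of fun a a' => X (x.1, a) (y.1, a') := rfl
    change N _ x.2 y.2 = c • N _ x.2 y.2
    rw [h, map_smul, Matrix.smul_apply]

/-- Quantum channels from `A` to `B`: completely positive trace-preserving linear maps. -/
structure QChannel (A B : Type*) [Fintype A] [Fintype B] where
  /-- the underlying linear map -/
  toLin : Matrix A A ℂ →ₗ[ℂ] Matrix B B ℂ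
  completelyPositive : ∀ (k : ℕ) (X : Matrix (Fin k × A) (Fin k × A) ℂ),
    X.PosSemidef → (ampl (Fin k) toLin X).PosSemidef
  tracePreserving : ∀ X : Matrix A A ℂ, (toLin X).trace = X.trace

/-- The output operator `(id_R ⊗ N)(ρ)`. -/
def QChannel.out [Fintype R] [Fintype A] [Fintype B] (N : QChannel A B) (ρ : State (R × A)) :
    Matrix (R × B) (R × B) ℂ :=
  ampl R N.toLin ρ.1

/-! ### Max-divergence -/

/-- `D_max(ρ₀ ‖ ρ₁) = inf {γ : ρ₀ ≤ 2 ^ γ ρ₁}`, equal to `⊤` if there is no such real `γ`. -/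
def maxDiv [Fintype H] (ρ₀ ρ₁ : Matrix H H ℂ) : EReal :=
  ⨅ (γ : ℝ) (_ : ((((2 : ℝ) ^ γ : ℝ) : ℂ) • ρ₁ - ρ₀).PosSemidef), (γ : EReal)

/-- The channel max-divergence: the supremum over all bipartite input states on `R A`. -/
def channelMaxDiv (R : Type*) [Fintype R] [Fintype A] [Fintype B] (N₀ N₁ : QChannel A B) : EReal :=
  ⨆ ρ : State (R × A), maxDiv (N₀.out ρ) (N₁.out ρ)

/-! ### Outcome distributions -/

/-- `P_{N, ρ, m}(y) = Tr[(id_R ⊗ N)(ρ) m_y]` (the trace is a nonnegative real number). -/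
def outcomeProb [Fintype R] [Fintype A] [Fintype B] [DecidableEq R] [DecidableEq B] {q : ℕ}
    (N : QChannel A B) (ρ : State (R × A)) (m : POVM (R × B) q) (y : Fin q) : ℝ :=
  (N.out ρ * m.1 y).trace.re

theorem QChannel.out_posSemidef [Fintype R] [Fintype A] [Fintype B] (N : QChannel A B) (ρ : State (R × A)) :
    (N.out ρ).PosSemidef := by
  let e := Fintype.equivFin R
  have h := N.completelyPositive _ _
    (ρ.2.1.submatrix (fun x : Fin (Fintype.card R) × A => (e.symm x.1, x.2)))
  have h2 := h.submatrix (fun x : R × B => (e x.1, x.2))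
  convert h2 using 1
  ext x y
  simp [QChannel.out, ampl]

theorem QChannel.out_trace [Fintype R] [Fintype A] [Fintype B] (N : QChannel A B) (ρ : State (R × A)) : (N.out ρ).trace = 1 := by
  rw [← ρ.2.2]
  have h : ∀ r : R, ∑ b, N.toLin (Matrix.of fun a a' => ρ.1 (r, a) (r, a')) b b =
      ∑ a, ρ.1 (r, a) (r, a) := fun r => N.tracePreserving _
  simp only [Matrix.trace, Matrix.diag, Fintype.sum_prod_type]
  exact Finset.sum_congr rfl fun r _ => h r

section Helpers

variable [Fintype R] [Fintype A] [Fintype B] [DecidableEq R] [DecidableEq B] {q : ℕ}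

open scoped MatrixOrder in
theorem outcomeProb_nonneg (N : QChannel A B) (ρ : State (R × A)) (m : POVM (R × B) q)
    (y : Fin q) : 0 ≤ outcomeProb N ρ m y := by
  obtain ⟨C, hC⟩ := CStarAlgebra.nonneg_iff_eq_star_mul_self.mp (m.2.1 y).nonneg
  have h := ((N.out_posSemidef ρ).mul_mul_conjTranspose_same C).trace_nonneg
  rw [Matrix.mul_assoc, Matrix.trace_mul_comm, Matrix.mul_assoc] at h
  unfold outcomeProb
  rw [hC]
  exact (Complex.nonneg_iff.mp h).1

theorem sum_outcomeProb (N : QChannel A B) (ρ : State (R × A)) (m : POVM (R × B) q) :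
    ∑ y, outcomeProb N ρ m y = 1 := by
  unfold outcomeProb
  rw [← Complex.re_sum, ← Matrix.trace_sum, ← Finset.mul_sum, m.2.2, mul_one, N.out_trace,
    Complex.one_re]

instance : SecondCountableTopology (Matrix R A ℂ) :=
  inferInstanceAs (SecondCountableTopology (R → A → ℂ))
instance : SecondCountableTopology (State R) := TopologicalSpace.Subtype.secondCountableTopology _
instance : SecondCountableTopology (POVM R q) := TopologicalSpace.Subtype.secondCountableTopology _

theorem measurable_outcomeProb (N : QChannel A B) (q : ℕ) :
    Measurable fun z : (State (R × A) × POVM (R × B) q) × Fin q =>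
      outcomeProb N z.1.1 z.1.2 z.2 := by
  refine measurable_from_prod_countable_left fun y => Continuous.measurable ?_
  have h1 : Continuous (ampl R N.toLin) := LinearMap.continuous_of_finiteDimensional _
  have h2 : Continuous fun z : State (R × A) × POVM (R × B) q => z.1.1 :=
    continuous_subtype_val.comp continuous_fst
  have h3 : Continuous fun z : State (R × A) × POVM (R × B) q => z.2.1 y :=
    (continuous_apply y).comp (continuous_subtype_val.comp continuous_snd)
  exact Complex.continuous_re.comp ((h1.comp h2).matrix_mul h3).matrix_trace

end Helpers

/-- The distribution `P_{N, ρ, m}` on the alphabet. -/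
def outcomeLaw [Fintype R] [Fintype A] [Fintype B] [DecidableEq R] [DecidableEq B] {q : ℕ}
    (N : QChannel A B) (ρ : State (R × A)) (m : POVM (R × B) q) : Measure (Fin q) :=
  Measure.count.withDensity fun y => ENNReal.ofReal (outcomeProb N ρ m y)

/-! ### Non-adaptive sequential strategies -/

/-- What the experimenter records in one round: input state, POVM and outcome. -/
abbrev Round (R A B : Type*) [Fintype R] [Fintype A] [Fintype B] [DecidableEq R] [DecidableEq B]
    (q : ℕ) : Type _ :=
  (State (R × A) × POVM (R × B) q) × Fin q

/-- A non-adaptive sequential strategy: a finite alphabet, laws `ν k` from which the input state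
and the POVM of the rounds `k = 0, 1, …` are drawn (independently of all other rounds), and
measurable decision functions; `d k` is applied to the records of the rounds `0, …, k`, its value
`none` means "continue" and its value `some i` means "stop and accept hypothesis `i`". -/
structure Strategy (R A B : Type*) [Fintype R] [Fintype A] [Fintype B]
    [DecidableEq R] [DecidableEq B] where
  /-- size of the alphabet -/
  q : ℕ
  /-- law of the input state and POVM of a round -/
  ν : ℕ → ProbabilityMeasure (State (R × A) × POVM (R × B) q)
  /-- decision functions -/
  d : (k : ℕ) → (Fin (k + 1) → Round R A B q) → Option (Fin 2)
  measurable_d : ∀ k c, MeasurableSet (d k ⁻¹' {c})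

namespace Strategy

variable [Fintype R] [Fintype A] [Fintype B] [DecidableEq R] [DecidableEq B]

/-- The law of the record of one round when the channel is `N`: it has density
`Tr[(id_R ⊗ N)(ρ) m_y]` with respect to `ν k (dρ, dm) ⊗ (counting measure)(dy)`. -/
def roundLaw (S : Strategy R A B) (N : QChannel A B) (k : ℕ) : Measure (Round R A B S.q) :=
  ((S.ν k : Measure (State (R × A) × POVM (R × B) S.q)).prod Measure.count).withDensity
    fun z => ENNReal.ofReal (outcomeProb N z.1.1 z.1.2 z.2)

theorem isProbabilityMeasure_roundLaw (S : Strategy R A B) (N : QChannel A B) (k : ℕ) :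
    IsProbabilityMeasure (S.roundLaw N k) := by
  constructor
  unfold roundLaw
  have hm := measurable_outcomeProb (R := R) N S.q
  rw [withDensity_apply _ MeasurableSet.univ, Measure.restrict_univ,
    lintegral_prod _ hm.ennreal_ofReal.aemeasurable]
  have h1 : ∀ z : State (R × A) × POVM (R × B) S.q,
      ∫⁻ y, ENNReal.ofReal (outcomeProb N z.1 z.2 y) ∂Measure.count = 1 := by
    intro z
    rw [lintegral_count, tsum_fintype,
      ← ENNReal.ofReal_sum_of_nonneg fun y _ => outcomeProb_nonneg N z.1 z.2 y,
      sum_outcomeProb, ENNReal.ofReal_one]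
  simp only [h1, lintegral_const, measure_univ, mul_one]

/-- The law of the whole (never stopped) sequence of records when the channel is `N`. -/
def law (S : Strategy R A B) (N : QChannel A B) : Measure (ℕ → Round R A B S.q) :=
  Measure.infinitePi (S.roundLaw N)

/-- The decision taken after the rounds `0, …, k`. -/
def decision (S : Strategy R A B) (ω : ℕ → Round R A B S.q) (k : ℕ) : Option (Fin 2) :=
  S.d k fun i => ω i

/-- The number of channel uses: the number of rounds up to and including the first one after which
the decision function does not say "continue"; `⊤` if there is none. -/
def stopTime (S : Strategy R A B) (ω : ℕ → Round R A B S.q) : ℕ∞ :=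
  ⨅ (k : ℕ) (_ : S.decision ω k ≠ none), ((k + 1 : ℕ) : ℕ∞)

/-- The event that the procedure stops and accepts hypothesis `i`. -/
def accepts (S : Strategy R A B) (i : Fin 2) : Set (ℕ → Round R A B S.q) :=
  {ω | ∃ k, S.decision ω k = some i ∧ ∀ j < k, S.decision ω j = none}

/-- Probability of accepting hypothesis `i` when the channel is `N`. -/
def acceptProb (S : Strategy R A B) (N : QChannel A B) (i : Fin 2) : ℝ≥0∞ :=
  S.law N (S.accepts i)

/-- Expected number of channel uses when the channel is `N`. -/
def expectedTime (S : Strategy R A B) (N : QChannel A B) : ℝ≥0∞ :=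
  ∫⁻ ω, (S.stopTime ω : ℝ≥0∞) ∂(S.law N)

/-- Probability that more than `n` channel uses are made when the channel is `N`. -/
def tailProb (S : Strategy R A B) (N : QChannel A B) (n : ℕ) : ℝ≥0∞ :=
  S.law N {ω | (n : ℕ∞) < S.stopTime ω}

end Strategy

/-! ### Error exponent regions -/

section Regions

variable [Fintype R] [Fintype A] [Fintype B] [DecidableEq R] [DecidableEq B]

/-- `liminf (1/n) log (1 / e_n)`, with `log (1 / 0) = ⊤`. -/
def errorExponent (e : ℕ → ℝ≥0∞) : EReal :=
  liminf (fun n : ℕ => ENNReal.log (1 / e n) / (n : EReal)) atTop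

/-- Both error probabilities of the sequence of strategies vanish, and they do so with exponents at
least `r.1` (wrongly accepting hypothesis 1) and `r.2` (wrongly accepting hypothesis 0). -/
def HasExponents (N₀ N₁ : QChannel A B) (S : ℕ → Strategy R A B) (r : ℝ × ℝ) : Prop :=
  (Tendsto (fun n => (S n).acceptProb N₀ 1) atTop (nhds 0) ∧
    Tendsto (fun n => (S n).acceptProb N₁ 0) atTop (nhds 0)) ∧
  (r.1 : EReal) ≤ errorExponent (fun n => (S n).acceptProb N₀ 1) ∧
  (r.2 : EReal) ≤ errorExponent (fun n => (S n).acceptProb N₁ 0)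

/-- Pairs achievable by non-adaptive strategies under the expectation constraint. -/
def regionE (R : Type*) [Fintype R] [DecidableEq R] (N₀ N₁ : QChannel A B) : Set (ℝ × ℝ) :=
  {r | 0 ≤ r.1 ∧ 0 ≤ r.2 ∧ ∃ S : ℕ → Strategy R A B, HasExponents N₀ N₁ S r ∧
    limsup (fun n : ℕ => ((max ((S n).expectedTime N₀) ((S n).expectedTime N₁) : ℝ≥0∞) : EReal)
      - (n : EReal)) atTop ≤ 0}

/-- Pairs achievable by non-adaptive strategies under the `ε`-probabilistic constraint. -/
def regionP (R : Type*) [Fintype R] [DecidableEq R] (ε : ℝ) (N₀ N₁ : QChannel A B) :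
    Set (ℝ × ℝ) :=
  {r | 0 ≤ r.1 ∧ 0 ≤ r.2 ∧ ∃ S : ℕ → Strategy R A B, HasExponents N₀ N₁ S r ∧
    limsup (fun n : ℕ => max ((S n).tailProb N₀ n) ((S n).tailProb N₁ n)) atTop
      < ENNReal.ofReal ε}

/-- The union, over all input states on `R A`, all finite alphabets and all POVMs on `R B`, of the
rectangles in the nonnegative quadrant bounded by the two relative entropies of the outcome
distributions. -/
def rectangles (R : Type*) [Fintype R] [DecidableEq R] (N₀ N₁ : QChannel A B) : Set (ℝ × ℝ) :=
  {r | 0 ≤ r.1 ∧ 0 ≤ r.2 ∧ ∃ (ρ : State (R × A)) (q : ℕ) (m : POVM (R × B) q),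
    ENNReal.ofReal r.1 ≤ InformationTheory.klDiv (outcomeLaw N₁ ρ m) (outcomeLaw N₀ ρ m) ∧
    ENNReal.ofReal r.2 ≤ InformationTheory.klDiv (outcomeLaw N₀ ρ m) (outcomeLaw N₁ ρ m)}

end Regions

end ChannelDisc

end

/-!
Write `p₀, p₁` for the outcome probabilities of one round under the two channels. Finiteness of both
max-divergences gives `p₀ ≤ exp K * p₁` and `p₁ ≤ exp K * p₀` with one `K` for all input states
and POVMs (`RatioBounded`, `exists_ratioBounded`). So the log-likelihood ratio of a round
is bounded, its means under the two channels are `D(P₀ ‖ P₁)` and `-D(P₁ ‖ P₀)` averaged over the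
law of the round (`RatioBounded.integral_logRatio`), and the ratio accumulated over `n` independent
rounds concentrates exponentially (Hoeffding, `infinitePi_sum_ge_le`).

*Converse.* Both constraints imply that for every `c > 1` the test has stopped by time `m = c * n`
with a probability bounded away from zero, under the expectation constraint by Markov's
inequality. The event of having stopped by time `m` with the correct decision depends only on the
first `m` records, so a change of measure and concentration bound its probability under the other
channel from below by `exp` of minus the relative entropy accumulated in `m` rounds
(`RatioBounded.eventually_exponent_le`). Because the same `m` serves for both hypotheses, the *pair*
of accumulated relative entropies is `m` times a point of the closed convex hull
(`RatioBounded.average_relEnt_mem`); that set is stable under shrinking coordinates, and `c → 1`.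

*Achievability.* A point of the convex hull is dominated by the means of the two relative
entropies under some law `ν` of input states and POVMs (`RatioBounded.exists_integral_relEnt_ge`).
Mixing in a little of a measurement that distinguishes the channels makes both means positive.
Drawing every round from `ν` and running the sequential probability ratio test with thresholds
slightly below `n` times the means gives errors of at most `exp` of minus the thresholds
(`Strategy.acceptProb_le_exp_neg`). The tail probabilities of the running time are
exponentially small from some `s * n` with `s < 1` on, so the expected time is at most `s * n + O(1)`
(`Strategy.eventually_expectedTime_le`), and one sequence of tests satisfies both constraints. A
diagonal argument reaches the boundary of the region.
-/

noncomputable section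

namespace ChannelDisc

/-! ### Change of measure and concentration for sequences of independent records -/

section ProductMeasures

variable {Ω : Type*} [MeasurableSpace Ω] {P Q : ℕ → Measure Ω}
  [∀ i, IsProbabilityMeasure (P i)] [∀ i, IsProbabilityMeasure (Q i)] {z : Ω → ℝ}

/-- The σ-algebra on sequences generated by the coordinates `0, …, n - 1`. -/
abbrev pastSigma (Ω : Type*) [MeasurableSpace Ω] (n : ℕ) : MeasurableSpace (ℕ → Ω) :=
  MeasurableSpace.comap (Finset.restrict (Finset.range n)) inferInstance

theorem pastSigma_le (n : ℕ) : pastSigma Ω n ≤ MeasurableSpace.pi :=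
  (Finset.measurable_restrict _).comap_le

theorem measurable_eval_pastSigma {n i : ℕ} (hi : i < n) :
    Measurable[pastSigma Ω n] fun ω : ℕ → Ω => ω i :=
  (measurable_pi_apply (⟨i, Finset.mem_range.2 hi⟩ : Finset.range n)).comp
    (comap_measurable (Finset.restrict (Finset.range n)))

theorem measurable_sum_eval_pastSigma (hz : Measurable z) (n : ℕ) :
    Measurable[pastSigma Ω n] fun ω : ℕ → Ω => ∑ i ∈ Finset.range n, z (ω i) :=
  Finset.measurable_sum _ fun _ hi =>
    hz.comp (measurable_eval_pastSigma (Finset.mem_range.1 hi))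

/-- On boxes both sides are products of integrals, by independence of the coordinates. -/
theorem map_restrict_infinitePi_withDensity (hz : Measurable z)
    (hPQ : ∀ i, P i = (Q i).withDensity fun x => ENNReal.ofReal (Real.exp (z x)))
    (I : Finset ℕ) :
    ((Measure.infinitePi Q).withDensity fun ω =>
        ∏ i ∈ I, ENNReal.ofReal (Real.exp (z (ω i)))).map I.restrict =
      (Measure.infinitePi P).map I.restrict := by
  classical
  rw [Measure.infinitePi_map_restrict]
  symm
  refine Measure.pi_eq fun t ht => ?_
  have hL : Measurable fun x => ENNReal.ofReal (Real.exp (z x)) := hz.exp.ennreal_ofReal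
  let f : ℕ → Ω → ℝ≥0∞ := fun i x => if h : i ∈ I then
    (t ⟨i, h⟩).indicator (fun x => ENNReal.ofReal (Real.exp (z x))) x else 0
  have hf : ∀ i, Measurable (f i) := by
    intro i
    by_cases h : i ∈ I
    · simpa only [f, h, dif_pos] using hL.indicator (ht ⟨i, h⟩)
    · simp only [f, h, dif_neg, not_false_eq_true, measurable_const]
  have hbox : MeasurableSet (I.restrict ⁻¹' (Set.univ.pi t) : Set (ℕ → Ω)) :=
    Finset.measurable_restrict _ (MeasurableSet.univ_pi ht)
  rw [Measure.map_apply (Finset.measurable_restrict _) (MeasurableSet.univ_pi ht),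
    withDensity_apply _ hbox, ← lintegral_indicator hbox]
  have key : ∀ ω : ℕ → Ω, (I.restrict ⁻¹' (Set.univ.pi t) : Set (ℕ → Ω)).indicator
      (fun ω => ∏ i ∈ I, ENNReal.ofReal (Real.exp (z (ω i)))) ω = ∏ i ∈ I, f i (ω i) := by
    intro ω
    by_cases hω : ω ∈ (I.restrict ⁻¹' (Set.univ.pi t) : Set (ℕ → Ω))
    · rw [Set.indicator_of_mem hω]
      refine Finset.prod_congr rfl fun i hi => ?_
      have : ω i ∈ t ⟨i, hi⟩ := hω ⟨i, hi⟩ (Set.mem_univ _)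
      simp only [f, hi, dif_pos, Set.indicator_of_mem this]
    · rw [Set.indicator_of_notMem hω]
      have : ∃ i : I, ω i ∉ t i := by
        by_contra! h
        exact hω fun i _ => h i
      obtain ⟨⟨i, hi⟩, h⟩ := this
      refine (Finset.prod_eq_zero hi ?_).symm
      simp only [f, hi, dif_pos, Set.indicator_of_notMem h]
  simp_rw [key]
  rw [ProbabilityTheory.lintegral_prod_eq_prod_lintegral_of_indepFun I
      (fun (i : ℕ) (ω : ℕ → Ω) => f i (ω i))
    (ProbabilityTheory.iIndepFun_infinitePi hf) (fun i => (hf i).comp (measurable_pi_apply i)),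
    ← Finset.prod_attach I]
  refine Finset.prod_congr rfl fun i _ => ?_
  have h1 : ∫⁻ ω, f i (ω i) ∂Measure.infinitePi Q = ∫⁻ x, f i x ∂(Q i) := by
    rw [← Measure.infinitePi_map_eval Q i, lintegral_map (hf i) (measurable_pi_apply _)]
  rw [h1, hPQ, withDensity_apply _ (ht i), ← lintegral_indicator (ht i)]
  refine lintegral_congr fun x => ?_
  simp only [f, i.2, dif_pos]

/-- Change of measure: on an event determined by the first `n` records, the likelihood ratio is
`exp (∑ i < n, z (ω i))`. -/
theorem infinitePi_eq_setLIntegral (hz : Measurable z)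
    (hPQ : ∀ i, P i = (Q i).withDensity fun x => ENNReal.ofReal (Real.exp (z x)))
    {n : ℕ} {E : Set (ℕ → Ω)} (hE : MeasurableSet[pastSigma Ω n] E) :
    Measure.infinitePi P E =
      ∫⁻ ω in E, ENNReal.ofReal (Real.exp (∑ i ∈ Finset.range n, z (ω i)))
        ∂(Measure.infinitePi Q) := by
  have hE' := pastSigma_le n _ hE
  obtain ⟨F, hF, rfl⟩ := hE
  rw [← Measure.map_apply (Finset.measurable_restrict _) hF,
    ← map_restrict_infinitePi_withDensity hz hPQ,
    Measure.map_apply (Finset.measurable_restrict _) hF, withDensity_apply _ hE']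
  refine lintegral_congr fun ω => ?_
  rw [Real.exp_sum, ENNReal.ofReal_prod_of_nonneg fun i _ => (Real.exp_pos _).le]

theorem infinitePi_le_exp_mul (hz : Measurable z)
    (hPQ : ∀ i, P i = (Q i).withDensity fun x => ENNReal.ofReal (Real.exp (z x)))
    {n : ℕ} {E : Set (ℕ → Ω)} (hE : MeasurableSet[pastSigma Ω n] E) {c : ℝ}
    (hc : ∀ ω ∈ E, ∑ i ∈ Finset.range n, z (ω i) ≤ c) :
    Measure.infinitePi P E ≤ ENNReal.ofReal (Real.exp c) * Measure.infinitePi Q E := by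
  rw [infinitePi_eq_setLIntegral hz hPQ hE, ← setLIntegral_const]
  exact setLIntegral_mono' (pastSigma_le n _ hE) fun ω hω =>
    ENNReal.ofReal_le_ofReal (Real.exp_le_exp.2 (hc ω hω))

/-- Hoeffding's inequality for a bounded function of independent, not necessarily identically
distributed records. -/
theorem infinitePi_sum_ge_le (hz : Measurable z) {K : ℝ} (hK : 0 < K)
    (hb : ∀ x, |z x| ≤ K) (n : ℕ) {δ : ℝ} (hδ : 0 ≤ δ) :
    Measure.infinitePi P {ω | (∑ i ∈ Finset.range n, ∫ x, z x ∂(P i)) + n * δ ≤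
        ∑ i ∈ Finset.range n, z (ω i)} ≤
      ENNReal.ofReal (Real.exp (-(δ ^ 2 / (2 * K ^ 2)) * n)) := by
  have hmean : ∀ i, ∫ ω, z (ω i) ∂(Measure.infinitePi P) = ∫ x, z x ∂(P i) := by
    intro i
    conv_rhs => rw [← Measure.infinitePi_map_eval P i]
    rw [integral_map (measurable_pi_apply _).aemeasurable hz.aestronglyMeasurable]
  have hind : ProbabilityTheory.iIndepFun (fun (i : ℕ) (ω : ℕ → Ω) => z (ω i) - ∫ x, z x ∂(P i))
      (Measure.infinitePi P) :=
    ProbabilityTheory.iIndepFun_infinitePi (X := fun i x => z x - ∫ x, z x ∂(P i))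
      fun i => hz.sub_const _
  have hsub : ∀ i < n, ProbabilityTheory.HasSubgaussianMGF
      (fun ω : ℕ → Ω => z (ω i) - ∫ x, z x ∂(P i)) ((‖K - -K‖₊ / 2) ^ 2)
      (Measure.infinitePi P) := by
    intro i _
    rw [← hmean i]
    exact ProbabilityTheory.hasSubgaussianMGF_of_mem_Icc
      (hz.comp (measurable_pi_apply i)).aemeasurable
      (ae_of_all _ fun ω => abs_le.1 (hb (ω i)))
  have h := ProbabilityTheory.HasSubgaussianMGF.measure_sum_range_ge_le_of_iIndepFun hind hsub
    (ε := n * δ) (by positivity)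
  have hset : {ω : ℕ → Ω | (∑ i ∈ Finset.range n, ∫ x, z x ∂(P i)) + n * δ ≤
        ∑ i ∈ Finset.range n, z (ω i)} =
      {ω | n * δ ≤ ∑ i ∈ Finset.range n, (z (ω i) - ∫ x, z x ∂(P i))} := by
    ext ω
    simp only [Set.mem_ofPred_eq, Finset.sum_sub_distrib]
    constructor <;> intro h <;> linarith
  rw [hset, ← ENNReal.ofReal_toReal (measure_ne_top (Measure.infinitePi P) _)]
  refine ENNReal.ofReal_le_ofReal (h.trans_eq ?_)
  congr 1
  have h2 : ((((‖K - -K‖₊ / 2) ^ 2 : NNReal)) : ℝ) = K ^ 2 := by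
    push_cast
    rw [Real.norm_of_nonneg (by linarith)]
    ring
  rw [h2]
  rcases Nat.eq_zero_or_pos n with rfl | hn
  · simp
  · have : (0 : ℝ) < n := by exact_mod_cast hn
    field_simp

theorem infinitePi_sum_le_le (hz : Measurable z) {K : ℝ} (hK : 0 < K)
    (hb : ∀ x, |z x| ≤ K) (n : ℕ) {δ : ℝ} (hδ : 0 ≤ δ) :
    Measure.infinitePi P {ω | ∑ i ∈ Finset.range n, z (ω i) ≤
        (∑ i ∈ Finset.range n, ∫ x, z x ∂(P i)) - n * δ} ≤
      ENNReal.ofReal (Real.exp (-(δ ^ 2 / (2 * K ^ 2)) * n)) := by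
  have h := infinitePi_sum_ge_le (P := P) hz.neg hK (by simpa using hb) n hδ
  refine (measure_mono fun ω hω => ?_).trans h
  simp only [Set.mem_ofPred_eq, Pi.neg_apply, Finset.sum_neg_distrib, integral_neg] at hω ⊢
  linarith

/-- The strong converse bound: an event of the first `n` records that is likely under `P` has
`Q`-probability at least about `exp (-∑ i < n, ∫ z ∂(P i))`. -/
theorem infinitePi_le_exp_mean_mul_add (hz : Measurable z)
    (hPQ : ∀ i, P i = (Q i).withDensity fun x => ENNReal.ofReal (Real.exp (z x)))
    {K : ℝ} (hK : 0 < K) (hb : ∀ x, |z x| ≤ K)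
    {n : ℕ} {E : Set (ℕ → Ω)} (hE : MeasurableSet[pastSigma Ω n] E) {δ : ℝ} (hδ : 0 ≤ δ) :
    Measure.infinitePi P E ≤
      ENNReal.ofReal (Real.exp ((∑ i ∈ Finset.range n, ∫ x, z x ∂(P i)) + n * δ)) *
        Measure.infinitePi Q E + ENNReal.ofReal (Real.exp (-(δ ^ 2 / (2 * K ^ 2)) * n)) := by
  set c := (∑ i ∈ Finset.range n, ∫ x, z x ∂(P i)) + n * δ with hc
  have hm : MeasurableSet[pastSigma Ω n] {ω : ℕ → Ω | ∑ i ∈ Finset.range n, z (ω i) ≤ c} :=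
    (measurable_sum_eval_pastSigma hz n) measurableSet_Iic
  calc Measure.infinitePi P E
      ≤ Measure.infinitePi P ((E ∩ {ω | ∑ i ∈ Finset.range n, z (ω i) ≤ c}) ∪
          {ω | c ≤ ∑ i ∈ Finset.range n, z (ω i)}) := by
        refine measure_mono fun ω hω => ?_
        rcases le_total (∑ i ∈ Finset.range n, z (ω i)) c with h | h
        · exact Or.inl ⟨hω, h⟩
        · exact Or.inr h
    _ ≤ _ := (measure_union_le _ _).trans (add_le_add ?_ (infinitePi_sum_ge_le hz hK hb n hδ))
  refine (infinitePi_le_exp_mul hz hPQ (MeasurableSet.inter hE hm) fun ω hω => hω.2).trans ?_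
  gcongr
  exact Set.inter_subset_left

end ProductMeasures

/-! ### Log-likelihood ratios of outcomes and their means -/

section Ratio

variable [Fintype R] [Fintype A] [Fintype B] [DecidableEq R] [DecidableEq B] {q : ℕ}
  {N₀ N₁ : QChannel A B} {K : ℝ}

/-- All outcome probabilities of the two channels agree up to the factor `exp K`, uniformly in the
input state and the POVM. -/
def RatioBounded (R : Type*) [Fintype R] [DecidableEq R] (K : ℝ) (N₀ N₁ : QChannel A B) : Prop :=
  ∀ (q : ℕ) (ρ : State (R × A)) (m : POVM (R × B) q) (y : Fin q),
    outcomeProb N₀ ρ m y ≤ Real.exp K * outcomeProb N₁ ρ m y ∧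
      outcomeProb N₁ ρ m y ≤ Real.exp K * outcomeProb N₀ ρ m y

theorem RatioBounded.symm (h : RatioBounded R K N₀ N₁) : RatioBounded R K N₁ N₀ :=
  fun q ρ m y => (h q ρ m y).symm

open scoped MatrixOrder in
theorem trace_mul_re_nonneg {H : Type*} [Fintype H] [DecidableEq H] {X M : Matrix H H ℂ}
    (hX : X.PosSemidef) (hM : M.PosSemidef) : 0 ≤ (X * M).trace.re := by
  obtain ⟨C, rfl⟩ := CStarAlgebra.nonneg_iff_eq_star_mul_self.mp hM.nonneg
  have h := (hX.mul_mul_conjTranspose_same C).trace_nonneg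
  rw [Matrix.mul_assoc, Matrix.trace_mul_comm, Matrix.mul_assoc] at h
  exact (Complex.nonneg_iff.mp h).1

theorem exists_outcomeProb_le_of_channelMaxDiv_lt_top (h : channelMaxDiv R N₀ N₁ < ⊤) :
    ∃ C : ℝ, ∀ (q : ℕ) (ρ : State (R × A)) (m : POVM (R × B) q) (y : Fin q),
      outcomeProb N₀ ρ m y ≤ Real.exp C * outcomeProb N₁ ρ m y := by
  obtain ⟨c, hc, -⟩ := EReal.lt_iff_exists_real_btwn.1 h
  refine ⟨Real.log 2 * c, fun q ρ m y => ?_⟩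
  have h1 : maxDiv (N₀.out ρ) (N₁.out ρ) < c :=
    (le_iSup (fun ρ : State (R × A) => maxDiv (N₀.out ρ) (N₁.out ρ)) ρ).trans_lt hc
  simp only [maxDiv, iInf_lt_iff] at h1
  obtain ⟨γ, hγ, hγc⟩ := h1
  have h2 := trace_mul_re_nonneg hγ (m.2.1 y)
  rw [Matrix.sub_mul, Matrix.trace_sub, Complex.sub_re, Matrix.smul_mul, Matrix.trace_smul,
    smul_eq_mul, Complex.re_ofReal_mul] at h2
  have h3 : outcomeProb N₀ ρ m y ≤ 2 ^ γ * outcomeProb N₁ ρ m y := by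
    unfold outcomeProb
    linarith
  refine h3.trans (mul_le_mul_of_nonneg_right ?_ (outcomeProb_nonneg N₁ ρ m y))
  rw [← Real.rpow_def_of_pos two_pos]
  exact Real.rpow_le_rpow_of_exponent_le one_le_two (EReal.coe_lt_coe_iff.1 hγc).le

theorem exists_ratioBounded
    (hfin : max (channelMaxDiv R N₀ N₁) (channelMaxDiv R N₁ N₀) < ⊤) :
    ∃ K : ℝ, 0 < K ∧ RatioBounded R K N₀ N₁ := by
  obtain ⟨C, hC⟩ := exists_outcomeProb_le_of_channelMaxDiv_lt_top (max_lt_iff.1 hfin).1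
  obtain ⟨D, hD⟩ := exists_outcomeProb_le_of_channelMaxDiv_lt_top (max_lt_iff.1 hfin).2
  refine ⟨max 1 (max C D), by positivity, fun q ρ m y => ⟨(hC q ρ m y).trans ?_,
    (hD q ρ m y).trans ?_⟩⟩
  · exact mul_le_mul_of_nonneg_right (Real.exp_le_exp.2 (by simp)) (outcomeProb_nonneg N₁ ρ m y)
  · exact mul_le_mul_of_nonneg_right (Real.exp_le_exp.2 (by simp)) (outcomeProb_nonneg N₀ ρ m y)

/-- The log-likelihood ratio of one record. Under `RatioBounded` the two probabilities vanish
together, and then its value `log (0 / 0) = 0` is harmless. -/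
def logRatio (N₀ N₁ : QChannel A B) (x : Round R A B q) : ℝ :=
  Real.log (outcomeProb N₀ x.1.1 x.1.2 x.2 / outcomeProb N₁ x.1.1 x.1.2 x.2)

theorem logRatio_swap (N₀ N₁ : QChannel A B) (x : Round R A B q) :
    logRatio N₁ N₀ x = -logRatio N₀ N₁ x := by
  rw [logRatio, logRatio, ← Real.log_inv, inv_div]

theorem measurable_logRatio (N₀ N₁ : QChannel A B) :
    Measurable (logRatio N₀ N₁ : Round R A B q → ℝ) :=
  ((measurable_outcomeProb N₀ q).div (measurable_outcomeProb N₁ q)).log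

theorem RatioBounded.exp_logRatio_mul (h : RatioBounded R K N₀ N₁) (x : Round R A B q) :
    Real.exp (logRatio N₀ N₁ x) * outcomeProb N₁ x.1.1 x.1.2 x.2 =
      outcomeProb N₀ x.1.1 x.1.2 x.2 := by
  obtain ⟨h0, h1⟩ := h q x.1.1 x.1.2 x.2
  have n0 := outcomeProb_nonneg N₀ x.1.1 x.1.2 x.2
  have n1 := outcomeProb_nonneg N₁ x.1.1 x.1.2 x.2
  unfold logRatio
  rcases n1.eq_or_lt with hz | hp
  · rw [← hz, mul_zero] at h0
    rw [← hz, mul_zero]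
    linarith
  · have hp0 : 0 < outcomeProb N₀ x.1.1 x.1.2 x.2 := by
      refine n0.lt_of_ne fun h => ?_
      rw [← h, mul_zero] at h1
      linarith
    rw [Real.exp_log (div_pos hp0 hp), div_mul_cancel₀ _ hp.ne']

theorem RatioBounded.logRatio_le (h : RatioBounded R K N₀ N₁) (hK : 0 ≤ K)
    (x : Round R A B q) : logRatio N₀ N₁ x ≤ K := by
  obtain ⟨h0, -⟩ := h q x.1.1 x.1.2 x.2
  have n0 := outcomeProb_nonneg N₀ x.1.1 x.1.2 x.2
  have n1 := outcomeProb_nonneg N₁ x.1.1 x.1.2 x.2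
  rcases (div_nonneg n0 n1).eq_or_lt with hz | hp
  · rw [logRatio, ← hz, Real.log_zero]
    exact hK
  · rw [logRatio, Real.log_le_iff_le_exp hp]
    exact div_le_of_le_mul₀ n1 (Real.exp_pos K).le h0

theorem RatioBounded.abs_logRatio_le (h : RatioBounded R K N₀ N₁) (hK : 0 ≤ K)
    (x : Round R A B q) : |logRatio N₀ N₁ x| ≤ K := by
  refine abs_le.2 ⟨?_, h.logRatio_le hK x⟩
  have := h.symm.logRatio_le hK x
  rw [logRatio_swap] at this
  linarith

theorem RatioBounded.roundLaw_eq_withDensity (h : RatioBounded R K N₀ N₁) (S : Strategy R A B)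
    (k : ℕ) : S.roundLaw N₀ k =
      (S.roundLaw N₁ k).withDensity fun x => ENNReal.ofReal (Real.exp (logRatio N₀ N₁ x)) := by
  unfold Strategy.roundLaw
  rw [← withDensity_mul _ (measurable_outcomeProb N₁ S.q).ennreal_ofReal
    (measurable_logRatio N₀ N₁).exp.ennreal_ofReal]
  congr 1
  ext x
  rw [Pi.mul_apply, mul_comm, ← ENNReal.ofReal_mul (Real.exp_pos _).le, h.exp_logRatio_mul]

/-- The relative entropy `D(P_{N₀, ρ, m} ‖ P_{N₁, ρ, m})`, as a real number. -/
def relEnt (N₀ N₁ : QChannel A B) (x : State (R × A) × POVM (R × B) q) : ℝ :=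
  ∑ y, outcomeProb N₀ x.1 x.2 y * logRatio N₀ N₁ (x, y)

theorem outcomeProb_le_one (N : QChannel A B) (ρ : State (R × A)) (m : POVM (R × B) q)
    (y : Fin q) : outcomeProb N ρ m y ≤ 1 := by
  rw [← sum_outcomeProb N ρ m]
  exact Finset.single_le_sum (fun y _ => outcomeProb_nonneg N ρ m y) (Finset.mem_univ y)

theorem measurable_relEnt (N₀ N₁ : QChannel A B) :
    Measurable (relEnt N₀ N₁ : State (R × A) × POVM (R × B) q → ℝ) := by
  refine Finset.measurable_sum _ fun y _ => ?_
  have hy : Measurable fun x : State (R × A) × POVM (R × B) q => (x, y) :=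
    measurable_id.prodMk measurable_const
  exact ((measurable_outcomeProb N₀ q).comp hy).mul ((measurable_logRatio N₀ N₁).comp hy)

theorem RatioBounded.abs_relEnt_le (h : RatioBounded R K N₀ N₁) (hK : 0 ≤ K)
    (x : State (R × A) × POVM (R × B) q) : |relEnt N₀ N₁ x| ≤ K := by
  calc |relEnt N₀ N₁ x| ≤ ∑ y, outcomeProb N₀ x.1 x.2 y * K := by
        refine (Finset.abs_sum_le_sum_abs _ _).trans (Finset.sum_le_sum fun y _ => ?_)
        rw [abs_mul, abs_of_nonneg (outcomeProb_nonneg N₀ x.1 x.2 y)]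
        exact mul_le_mul_of_nonneg_left (h.abs_logRatio_le hK _) (outcomeProb_nonneg N₀ x.1 x.2 y)
    _ = K := by rw [← Finset.sum_mul, sum_outcomeProb, one_mul]

theorem RatioBounded.integrable_relEnt (h : RatioBounded R K N₀ N₁) (hK : 0 ≤ K)
    (ν : Measure (State (R × A) × POVM (R × B) q)) [IsFiniteMeasure ν] :
    Integrable (relEnt N₀ N₁) ν :=
  Integrable.of_bound (measurable_relEnt N₀ N₁).aestronglyMeasurable K
    (ae_of_all _ fun x => h.abs_relEnt_le hK x)

theorem RatioBounded.integral_logRatio (h : RatioBounded R K N₀ N₁) (hK : 0 ≤ K)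
    (S : Strategy R A B) (k : ℕ) :
    ∫ x, logRatio N₀ N₁ x ∂(S.roundLaw N₀ k) = ∫ x, relEnt N₀ N₁ x ∂(S.ν k : Measure (State (R × A) × POVM (R × B) S.q)) := by
  have hm := measurable_outcomeProb (R := R) N₀ S.q
  unfold Strategy.roundLaw
  rw [integral_withDensity_eq_integral_toReal_smul hm.ennreal_ofReal
    (ae_of_all _ fun _ => ENNReal.ofReal_lt_top), integral_prod]
  · refine integral_congr_ae (ae_of_all _ fun x => ?_)
    simp only [integral_count, relEnt, smul_eq_mul]
    refine Finset.sum_congr rfl fun y _ => ?_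
    rw [ENNReal.toReal_ofReal (outcomeProb_nonneg N₀ _ _ _)]
  · refine Integrable.of_bound
      (hm.ennreal_ofReal.ennreal_toReal.mul (measurable_logRatio N₀ N₁)).aestronglyMeasurable
      K (ae_of_all _ fun x => ?_)
    rw [ENNReal.toReal_ofReal (outcomeProb_nonneg N₀ _ _ _), smul_eq_mul, norm_mul,
      Real.norm_of_nonneg (outcomeProb_nonneg N₀ _ _ _), Real.norm_eq_abs]
    calc _ ≤ 1 * K := mul_le_mul (outcomeProb_le_one N₀ _ _ _) (h.abs_logRatio_le hK x)
            (abs_nonneg _) zero_le_one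
      _ = K := one_mul K

instance isProbabilityMeasure_outcomeLaw (N : QChannel A B) (ρ : State (R × A))
    (m : POVM (R × B) q) : IsProbabilityMeasure (outcomeLaw N ρ m) := by
  constructor
  rw [outcomeLaw, withDensity_apply _ MeasurableSet.univ, Measure.restrict_univ, lintegral_count,
    tsum_fintype, ← ENNReal.ofReal_sum_of_nonneg fun y _ => outcomeProb_nonneg N ρ m y,
    sum_outcomeProb, ENNReal.ofReal_one]

theorem RatioBounded.outcomeLaw_eq_withDensity (h : RatioBounded R K N₀ N₁)
    (ρ : State (R × A)) (m : POVM (R × B) q) :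
    outcomeLaw N₀ ρ m = (outcomeLaw N₁ ρ m).withDensity
      fun y => ENNReal.ofReal (Real.exp (logRatio N₀ N₁ ((ρ, m), y))) := by
  unfold outcomeLaw
  rw [← withDensity_mul _ (measurable_of_finite _) (measurable_of_finite _)]
  congr 1
  ext y
  rw [Pi.mul_apply, mul_comm, ← ENNReal.ofReal_mul (Real.exp_pos _).le]
  exact congrArg _ (h.exp_logRatio_mul ((ρ, m), y)).symm

theorem RatioBounded.outcomeLaw_absolutelyContinuous (h : RatioBounded R K N₀ N₁)
    (ρ : State (R × A)) (m : POVM (R × B) q) : outcomeLaw N₀ ρ m ≪ outcomeLaw N₁ ρ m := by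
  rw [h.outcomeLaw_eq_withDensity]
  exact withDensity_absolutelyContinuous _ _

theorem RatioBounded.klDiv_ne_top (h : RatioBounded R K N₀ N₁)
    (ρ : State (R × A)) (m : POVM (R × B) q) :
    InformationTheory.klDiv (outcomeLaw N₀ ρ m) (outcomeLaw N₁ ρ m) ≠ ⊤ :=
  InformationTheory.klDiv_ne_top (h.outcomeLaw_absolutelyContinuous ρ m) Integrable.of_finite

theorem RatioBounded.toReal_klDiv (h : RatioBounded R K N₀ N₁)
    (ρ : State (R × A)) (m : POVM (R × B) q) :
    (InformationTheory.klDiv (outcomeLaw N₀ ρ m) (outcomeLaw N₁ ρ m)).toReal =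
      relEnt N₀ N₁ (ρ, m) := by
  have hac := h.outcomeLaw_absolutelyContinuous ρ m
  have hd : (outcomeLaw N₀ ρ m).rnDeriv (outcomeLaw N₁ ρ m) =ᵐ[outcomeLaw N₁ ρ m]
      fun y => ENNReal.ofReal (Real.exp (logRatio N₀ N₁ ((ρ, m), y))) := by
    rw [h.outcomeLaw_eq_withDensity]
    exact Measure.rnDeriv_withDensity _ (measurable_of_finite _)
  rw [InformationTheory.toReal_klDiv_of_measure_eq hac (by simp)]
  have h1 : llr (outcomeLaw N₀ ρ m) (outcomeLaw N₁ ρ m) =ᵐ[outcomeLaw N₀ ρ m]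
      fun y => logRatio N₀ N₁ ((ρ, m), y) := by
    filter_upwards [hac.ae_le hd] with y hy
    rw [llr, hy, ENNReal.toReal_ofReal (Real.exp_pos _).le, Real.log_exp]
  rw [integral_congr_ae h1, outcomeLaw, integral_withDensity_eq_integral_toReal_smul
    (measurable_of_finite _) (ae_of_all _ fun _ => ENNReal.ofReal_lt_top), integral_count]
  refine Finset.sum_congr rfl fun y _ => ?_
  rw [ENNReal.toReal_ofReal (outcomeProb_nonneg N₀ _ _ _), smul_eq_mul]

theorem RatioBounded.relEnt_nonneg (h : RatioBounded R K N₀ N₁)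
    (x : State (R × A) × POVM (R × B) q) : 0 ≤ relEnt N₀ N₁ x :=
  h.toReal_klDiv x.1 x.2 ▸ ENNReal.toReal_nonneg

theorem RatioBounded.ofReal_le_klDiv_iff (h : RatioBounded R K N₀ N₁)
    (ρ : State (R × A)) (m : POVM (R × B) q) {r : ℝ} :
    ENNReal.ofReal r ≤ InformationTheory.klDiv (outcomeLaw N₀ ρ m) (outcomeLaw N₁ ρ m) ↔
      r ≤ relEnt N₀ N₁ (ρ, m) := by
  rw [ENNReal.ofReal_le_iff_le_toReal (h.klDiv_ne_top ρ m), h.toReal_klDiv]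

theorem RatioBounded.relEnt_pos (h : RatioBounded R K N₀ N₁)
    {ρ : State (R × A)} {m : POVM (R × B) q} {y : Fin q}
    (hy : outcomeProb N₀ ρ m y ≠ outcomeProb N₁ ρ m y) : 0 < relEnt N₀ N₁ (ρ, m) := by
  refine (h.relEnt_nonneg _).lt_of_ne fun h0 => hy ?_
  rw [← h.toReal_klDiv] at h0
  have h1 := ((ENNReal.toReal_eq_zero_iff _).1 h0.symm).resolve_right (h.klDiv_ne_top ρ m)
  have h2 := congrArg (fun μ : Measure (Fin q) => μ {y})
    (InformationTheory.klDiv_eq_zero_iff.1 h1)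
  simp only [outcomeLaw, withDensity_apply _ (measurableSet_singleton y),
    lintegral_singleton, Measure.count_singleton, mul_one] at h2
  exact (ENNReal.ofReal_eq_ofReal_iff (outcomeProb_nonneg _ _ _ _)
    (outcomeProb_nonneg _ _ _ _)).1 h2

end Ratio

/-! ### Distinct channels are distinguished by some measurement -/

section Distinguish

open scoped Matrix.Norms.L2Operator MatrixOrder

/-- Linear functionals that agree on all states agree everywhere, because positive elements span
the matrix algebra. -/
theorem linearMap_eq_of_eq_on_states {H : Type*} [Fintype H] [DecidableEq H] {V : Type*}
    [AddCommGroup V] [Module ℂ V] {f g : Matrix H H ℂ →ₗ[ℂ] V}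
    (h : ∀ ρ : State H, f ρ.1 = g ρ.1) : f = g := by
  refine LinearMap.ext_on CStarAlgebra.span_nonneg fun X hX => ?_
  have hX' : X.PosSemidef := Matrix.nonneg_iff_posSemidef.1 hX
  by_cases ht : X.trace = 0
  · rw [hX'.trace_eq_zero_iff.1 ht, map_zero, map_zero]
  · have h1 := h ⟨X.trace⁻¹ • X, hX'.smul (by
      rw [inv_nonneg]; exact hX'.trace_nonneg), by
      rw [Matrix.trace_smul, smul_eq_mul, inv_mul_cancel₀ ht]⟩
    simp only [map_smul] at h1
    exact smul_right_injective V (inv_ne_zero ht) h1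

/-- A matrix with vanishing trace against all effects `0 ≤ M ≤ 1` is zero. -/
theorem eq_zero_of_trace_mul_effect {H : Type*} [Fintype H] [DecidableEq H] {Y : Matrix H H ℂ}
    (h : ∀ M : Matrix H H ℂ, M.PosSemidef → (1 - M).PosSemidef → (Y * M).trace = 0) : Y = 0 := by
  have hf : (Matrix.traceLinearMap H ℂ ℂ).comp (LinearMap.mulLeft ℂ Y) = 0 := by
    refine LinearMap.ext_on CStarAlgebra.span_nonneg_inter_unitClosedBall fun M hM => ?_
    have h0 : 0 ≤ M := hM.1
    have h1 : M ≤ 1 := (CStarAlgebra.norm_le_one_iff_of_nonneg M h0).1 (by simpa using hM.2)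
    exact h M (Matrix.nonneg_iff_posSemidef.1 h0) (Matrix.le_iff.1 h1)
  have h2 : (Y * Y.conjTranspose).trace = 0 := LinearMap.congr_fun hf Y.conjTranspose
  exact Matrix.trace_mul_conjTranspose_self_eq_zero_iff.1 h2

variable [Fintype R] [Fintype A] [Fintype B] [DecidableEq R] [Nonempty R]
  {N₀ N₁ : QChannel A B}

theorem exists_out_ne (hne : N₀.toLin ≠ N₁.toLin) :
    ∃ ρ : State (R × A), N₀.out ρ ≠ N₁.out ρ := by
  classical
  by_contra! h
  have h1 : ampl R N₀.toLin = ampl R N₁.toLin := linearMap_eq_of_eq_on_states h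
  refine hne (LinearMap.ext fun X => ?_)
  obtain ⟨r⟩ := ‹Nonempty R›
  ext b b'
  exact congrFun (congrFun (LinearMap.congr_fun h1
    (Matrix.of fun x y : R × A => X x.2 y.2)) (r, b)) (r, b')

theorem exists_outcomeProb_ne [DecidableEq B] (hne : N₀.toLin ≠ N₁.toLin) :
    ∃ (ρ : State (R × A)) (m : POVM (R × B) 2) (y : Fin 2),
      outcomeProb N₀ ρ m y ≠ outcomeProb N₁ ρ m y := by
  obtain ⟨ρ, hρ⟩ := exists_out_ne (R := R) hne
  by_contra! h
  refine hρ (sub_eq_zero.1 (eq_zero_of_trace_mul_effect fun M h0 h1 => ?_))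
  have hre := h ρ ⟨![M, 1 - M], by
    intro y
    fin_cases y
    · exact h0
    · exact h1, by simp⟩ 0
  have him : ∀ N : QChannel A B, (N.out ρ * M).trace.im = 0 := by
    intro N
    obtain ⟨C, hC⟩ := CStarAlgebra.nonneg_iff_eq_star_mul_self.mp h0.nonneg
    have h := ((N.out_posSemidef ρ).mul_mul_conjTranspose_same C).trace_nonneg
    rw [Matrix.mul_assoc, Matrix.trace_mul_comm, Matrix.mul_assoc] at h
    rw [hC]
    exact (Complex.nonneg_iff.mp h).2.symm
  rw [Matrix.sub_mul, Matrix.trace_sub]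
  refine Complex.ext ?_ ?_
  · simpa [outcomeProb, sub_eq_zero] using hre
  · rw [Complex.sub_im, him, him, sub_zero, Complex.zero_im]

end Distinguish

/-! ### Error exponents as exponential bounds -/

theorem coe_le_log_inv_div_iff {n : ℕ} (hn : 0 < n) {s : ℝ} {e : ℝ≥0∞} :
    (s : EReal) ≤ ENNReal.log (1 / e) / (n : EReal) ↔
      e ≤ ENNReal.ofReal (Real.exp (-(n * s))) := by
  have hn' : (0 : EReal) < (n : EReal) := by exact_mod_cast hn
  rw [EReal.le_div_iff_mul_le hn' (EReal.natCast_ne_top n), one_div, ENNReal.log_inv,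
    EReal.le_neg, ← ENNReal.log_le_log_iff (x := e), ENNReal.log_ofReal_of_pos (Real.exp_pos _),
    Real.log_exp]
  have : (s : EReal) * (n : EReal) = ((n * s : ℝ) : EReal) := by
    rw [mul_comm (n : ℝ), EReal.coe_mul, EReal.coe_natCast]
  rw [this, ← EReal.coe_neg]

theorem coe_le_errorExponent_iff {e : ℕ → ℝ≥0∞} {r : ℝ} :
    (r : EReal) ≤ errorExponent e ↔
      ∀ η > 0, ∀ᶠ n : ℕ in atTop, e n ≤ ENNReal.ofReal (Real.exp (-(n * (r - η)))) := by
  rw [errorExponent, le_liminf_iff]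
  constructor
  · intro h η hη
    filter_upwards [h ((r - η : ℝ) : EReal) (EReal.coe_lt_coe_iff.2 (by linarith)),
      eventually_gt_atTop 0] with n hn hn0
    exact (coe_le_log_inv_div_iff hn0).1 hn.le
  · intro h y hy
    obtain ⟨t, hyt, htr⟩ := EReal.lt_iff_exists_real_btwn.1 hy
    filter_upwards [h (r - t) (by linarith [EReal.coe_lt_coe_iff.1 htr]),
      eventually_gt_atTop 0] with n hn hn0
    rw [sub_sub_cancel] at hn
    exact hyt.trans_le ((coe_le_log_inv_div_iff hn0).2 hn)

section Region

variable [Fintype R] [Fintype A] [Fintype B] [DecidableEq R] [DecidableEq B] {q : ℕ}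
  {N₀ N₁ : QChannel A B} {K : ℝ}

/-! ### The closed convex hull of the rectangles -/

/-- The union of rectangles is stable under shrinking the coordinates, hence so is its closed
convex hull. -/
theorem mem_closure_convexHull_rectangles_of_le {a b : ℝ × ℝ}
    (hb : b ∈ closure (convexHull ℝ (rectangles R N₀ N₁)))
    (h1 : 0 ≤ a.1) (h2 : 0 ≤ a.2) (hab1 : a.1 ≤ b.1) (hab2 : a.2 ≤ b.2) :
    a ∈ closure (convexHull ℝ (rectangles R N₀ N₁)) := by
  have hscale : ∀ x y : ℝ, 0 ≤ x → x ≤ y → ∃ s : ℝ, 0 ≤ s ∧ s ≤ 1 ∧ s * y = x := by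
    intro x y hx hxy
    rcases hx.eq_or_lt with rfl | hx
    · exact ⟨0, le_rfl, zero_le_one, zero_mul _⟩
    · have hy := hx.trans_le hxy
      exact ⟨x / y, by positivity, (div_le_one hy).2 hxy, div_mul_cancel₀ _ hy.ne'⟩
  obtain ⟨s, hs0, hs1, hs⟩ := hscale _ _ h1 hab1
  obtain ⟨t, ht0, ht1, ht⟩ := hscale _ _ h2 hab2
  let f : ℝ × ℝ →L[ℝ] ℝ × ℝ :=
    (s • ContinuousLinearMap.id ℝ ℝ).prodMap (t • ContinuousLinearMap.id ℝ ℝ)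
  have hf : Set.MapsTo f (rectangles R N₀ N₁) (rectangles R N₀ N₁) := by
    rintro x ⟨hx1, hx2, ρ, q, m, h3, h4⟩
    refine ⟨mul_nonneg hs0 hx1, mul_nonneg ht0 hx2, ρ, q, m, ?_, ?_⟩
    · exact (ENNReal.ofReal_le_ofReal (mul_le_of_le_one_left hx1 hs1)).trans h3
    · exact (ENNReal.ofReal_le_ofReal (mul_le_of_le_one_left hx2 ht1)).trans h4
  have hf2 : Set.MapsTo f (convexHull ℝ (rectangles R N₀ N₁))
      (convexHull ℝ (rectangles R N₀ N₁)) := by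
    intro x hx
    have h5 : f x ∈ f '' convexHull ℝ (rectangles R N₀ N₁) := ⟨x, hx, rfl⟩
    rw [show (f '' convexHull ℝ (rectangles R N₀ N₁)) =
      convexHull ℝ (f '' rectangles R N₀ N₁) from
        f.toLinearMap.image_convexHull (rectangles R N₀ N₁)] at h5
    exact convexHull_mono hf.image_subset h5
  have h6 := hf2.closure f.continuous hb
  have h7 : f b = a := Prod.ext hs ht
  rwa [h7] at h6

theorem RatioBounded.relEnt_mem_rectangles (h : RatioBounded R K N₀ N₁)
    (x : State (R × A) × POVM (R × B) q) :
    (relEnt N₁ N₀ x, relEnt N₀ N₁ x) ∈ rectangles R N₀ N₁ :=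
  ⟨h.symm.relEnt_nonneg x, h.relEnt_nonneg x, x.1, q, x.2,
    (h.symm.ofReal_le_klDiv_iff _ _).2 le_rfl, (h.ofReal_le_klDiv_iff _ _).2 le_rfl⟩

theorem RatioBounded.integral_relEnt_mem (h : RatioBounded R K N₀ N₁) (hK : 0 ≤ K)
    (ν : Measure (State (R × A) × POVM (R × B) q)) [IsProbabilityMeasure ν] :
    (∫ x, relEnt N₁ N₀ x ∂ν, ∫ x, relEnt N₀ N₁ x ∂ν) ∈
      closure (convexHull ℝ (rectangles R N₀ N₁)) := by
  have h1 := h.symm.integrable_relEnt hK ν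
  have h2 := h.integrable_relEnt hK ν
  rw [← integral_pair h1 h2]
  exact (convex_convexHull ℝ _).closure.integral_mem isClosed_closure
    (ae_of_all _ fun x => subset_closure (subset_convexHull ℝ _ (h.relEnt_mem_rectangles x)))
    (h1.prodMk h2)

theorem RatioBounded.average_relEnt_mem (h : RatioBounded R K N₀ N₁) (hK : 0 ≤ K)
    (S : Strategy R A B) {n : ℕ} (hn : 0 < n) :
    ((∑ k ∈ Finset.range n, ∫ x, logRatio N₁ N₀ x ∂(S.roundLaw N₁ k)) / n,
      (∑ k ∈ Finset.range n, ∫ x, logRatio N₀ N₁ x ∂(S.roundLaw N₀ k)) / n) ∈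
      closure (convexHull ℝ (rectangles R N₀ N₁)) := by
  have hn' : (n : ℝ) ≠ 0 := by exact_mod_cast hn.ne'
  have h1 := (convex_convexHull ℝ (rectangles R N₀ N₁)).closure.sum_mem
    (t := Finset.range n) (w := fun _ => (1 / n : ℝ))
    (z := fun k => (∫ x, relEnt N₁ N₀ x ∂(S.ν k : Measure (State (R × A) × POVM (R × B) S.q)),
      ∫ x, relEnt N₀ N₁ x ∂(S.ν k : Measure (State (R × A) × POVM (R × B) S.q))))
    (fun _ _ => by positivity) (by simp [hn']) (fun k _ => h.integral_relEnt_mem hK _)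
  convert h1 using 1
  refine Prod.ext ?_ ?_
  · simp only [Prod.fst_sum, Prod.smul_fst, smul_eq_mul, h.symm.integral_logRatio hK,
      ← Finset.mul_sum]
    ring
  · simp only [Prod.snd_sum, Prod.smul_snd, smul_eq_mul, h.integral_logRatio hK,
      ← Finset.mul_sum]
    ring

/-! ### The strong converse -/

namespace Strategy

instance (S : Strategy R A B) (N : QChannel A B) (k : ℕ) :
    IsProbabilityMeasure (S.roundLaw N k) := S.isProbabilityMeasure_roundLaw N k

instance (S : Strategy R A B) (N : QChannel A B) : IsProbabilityMeasure (S.law N) := by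
  unfold law
  infer_instance

theorem measurableSet_decision_eq (S : Strategy R A B) {k n : ℕ} (hk : k < n)
    (c : Option (Fin 2)) : MeasurableSet[pastSigma (Round R A B S.q) n]
      {ω : ℕ → Round R A B S.q | S.decision ω k = c} := by
  have h : Measurable[pastSigma (Round R A B S.q) n]
      fun (ω : ℕ → Round R A B S.q) (i : Fin (k + 1)) => ω i :=
    @measurable_pi_lambda _ _ _ (pastSigma (Round R A B S.q) n) _ _
      fun i => measurable_eval_pastSigma (by omega)
  exact h (S.measurable_d k c)

/-- The event of stopping within the first `n` rounds and accepting hypothesis `i`. -/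
def acceptsBefore (S : Strategy R A B) (n : ℕ) (i : Fin 2) : Set (ℕ → Round R A B S.q) :=
  ⋃ k < n, {ω | S.decision ω k = some i} ∩ ⋂ j < k, {ω | S.decision ω j = none}

theorem measurableSet_acceptsBefore (S : Strategy R A B) (n : ℕ) (i : Fin 2) :
    MeasurableSet[pastSigma (Round R A B S.q) n] (S.acceptsBefore n i) := by
  refine MeasurableSet.iUnion fun k => MeasurableSet.iUnion fun hk => MeasurableSet.inter
    (S.measurableSet_decision_eq hk _) ?_
  exact MeasurableSet.iInter fun j => MeasurableSet.iInter fun hj =>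
    S.measurableSet_decision_eq (hj.trans hk) _

theorem acceptsBefore_subset (S : Strategy R A B) (n : ℕ) (i : Fin 2) :
    S.acceptsBefore n i ⊆ S.accepts i := by
  intro ω hω
  simp only [acceptsBefore, Set.mem_iUnion, Set.mem_inter_iff, Set.mem_iInter] at hω
  obtain ⟨k, -, h1, h2⟩ := hω
  exact ⟨k, h1, h2⟩

theorem lt_stopTime_iff (S : Strategy R A B) (n : ℕ) (ω : ℕ → Round R A B S.q) :
    (n : ℕ∞) < S.stopTime ω ↔ ∀ k < n, S.decision ω k = none := by
  constructor
  · intro h k hk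
    by_contra hne
    have h1 : S.stopTime ω ≤ ((k + 1 : ℕ) : ℕ∞) := iInf₂_le k hne
    have h2 := h.trans_le h1
    have h3 : n < k + 1 := by exact_mod_cast h2
    omega
  · intro h
    refine (ENat.add_one_le_iff (ENat.natCast_ne_top n)).1 (le_iInf₂ fun k hk => ?_)
    have : n ≤ k := by
      by_contra! hlt
      exact hk (h k hlt)
    exact_mod_cast Nat.succ_le_succ this

theorem measurableSet_lt_stopTime (S : Strategy R A B) (n : ℕ) :
    MeasurableSet {ω : ℕ → Round R A B S.q | (n : ℕ∞) < S.stopTime ω} := by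
  have : {ω : ℕ → Round R A B S.q | (n : ℕ∞) < S.stopTime ω} =
      ⋂ k, ⋂ (_ : k < n), {ω | S.decision ω k = none} := by
    ext ω
    simp [lt_stopTime_iff]
  rw [this]
  exact MeasurableSet.iInter fun k => MeasurableSet.iInter fun hk =>
    pastSigma_le n _ (S.measurableSet_decision_eq hk _)

theorem one_le_acceptsBefore_add (S : Strategy R A B) (N : QChannel A B) (n : ℕ) {i j : Fin 2}
    (hij : i ≠ j) :
    1 ≤ S.law N (S.acceptsBefore n i) + S.acceptProb N j + S.tailProb N n := by
  have hcover : (Set.univ : Set (ℕ → Round R A B S.q)) ⊆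
      S.acceptsBefore n i ∪ S.accepts j ∪ {ω | (n : ℕ∞) < S.stopTime ω} := by
    intro ω _
    by_cases hω : ∃ k, k < n ∧ S.decision ω k ≠ none
    · classical
      obtain ⟨hk, hne⟩ := Nat.find_spec hω
      have hmin : ∀ l < Nat.find hω, S.decision ω l = none := fun l hl => by
        by_contra h
        exact Nat.find_min hω hl ⟨hl.trans hk, h⟩
      obtain ⟨c, hc⟩ := Option.ne_none_iff_exists'.1 hne
      rcases eq_or_ne c i with rfl | hci
      · refine Or.inl (Or.inl ?_)
        simp only [acceptsBefore, Set.mem_iUnion, Set.mem_inter_iff, Set.mem_iInter]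
        exact ⟨_, hk, hc, hmin⟩
      · have : c = j := by omega
        subst this
        exact Or.inl (Or.inr ⟨_, hc, hmin⟩)
    · push Not at hω
      exact Or.inr ((S.lt_stopTime_iff n ω).2 hω)
  calc (1 : ℝ≥0∞) = S.law N Set.univ := measure_univ.symm
    _ ≤ _ := (measure_mono hcover).trans ((measure_union_le _ _).trans
      (add_le_add (measure_union_le _ _) le_rfl))

/-- The strong converse for a single strategy: if under `N₀` the wrong decision `j` and the running
time exceeding `n` are not almost sure, then the probability of deciding `i` under `N₁` is not much
smaller than the exponential of minus the accumulated relative entropy. -/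
theorem one_le_exp_mul_acceptProb_add (h : RatioBounded R K N₀ N₁) (hK : 0 < K)
    (S : Strategy R A B) (n : ℕ) {i j : Fin 2} (hij : i ≠ j) {δ : ℝ} (hδ : 0 ≤ δ) :
    1 ≤ ENNReal.ofReal (Real.exp ((∑ k ∈ Finset.range n,
        ∫ x, logRatio N₀ N₁ x ∂(S.roundLaw N₀ k)) + n * δ)) * S.acceptProb N₁ i +
      ENNReal.ofReal (Real.exp (-(δ ^ 2 / (2 * K ^ 2)) * n)) +
      S.acceptProb N₀ j + S.tailProb N₀ n := by
  refine (S.one_le_acceptsBefore_add N₀ n hij).trans ?_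
  gcongr
  refine (infinitePi_le_exp_mean_mul_add (P := S.roundLaw N₀) (Q := S.roundLaw N₁)
    (measurable_logRatio N₀ N₁) (h.roundLaw_eq_withDensity S) hK (h.abs_logRatio_le hK.le)
    (S.measurableSet_acceptsBefore n i) hδ).trans ?_
  gcongr
  exact measure_mono (S.acceptsBefore_subset n i)

end Strategy

theorem tendsto_ofReal_exp_neg_mul {c : ℝ} (hc : 0 < c) :
    Tendsto (fun n : ℕ => ENNReal.ofReal (Real.exp (-c * n))) atTop (nhds 0) := by
  rw [← ENNReal.ofReal_zero]
  refine ENNReal.tendsto_ofReal (Real.tendsto_exp_atBot.comp ?_)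
  exact tendsto_natCast_atTop_atTop.const_mul_atTop_of_neg (by linarith)

/-- If the running time stays below `c * n` with non-vanishing probability, then an exponent of the
decision `i` under `N₁` is at most the relative entropy accumulated in `c * n` rounds. -/
theorem RatioBounded.eventually_exponent_le (h : RatioBounded R K N₀ N₁) (hK : 0 < K)
    {S : ℕ → Strategy R A B} {i j : Fin 2} (hij : i ≠ j) {c : ℝ} (hc : 0 < c)
    (hα : Tendsto (fun n => (S n).acceptProb N₀ j) atTop (nhds 0)) {θ : ℝ≥0∞} (hθ : θ < 1)
    (htail : ∀ᶠ n : ℕ in atTop, (S n).tailProb N₀ ⌊c * n⌋₊ ≤ θ) {r : ℝ}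
    (hr : (r : EReal) ≤ errorExponent fun n => (S n).acceptProb N₁ i) {η : ℝ} (hη : 0 < η) :
    ∀ᶠ n : ℕ in atTop, n * (r - η) ≤
      ∑ k ∈ Finset.range ⌊c * n⌋₊, ∫ x, logRatio N₀ N₁ x ∂((S n).roundLaw N₀ k) := by
  obtain ⟨κ, hκ0, hκ⟩ : ∃ κ : ℝ, 0 < κ ∧ ENNReal.ofReal κ + ENNReal.ofReal κ
      + ENNReal.ofReal κ + θ < 1 := by
    obtain ⟨t, ht0, rfl⟩ : ∃ t : ℝ, 0 ≤ t ∧ θ = ENNReal.ofReal t :=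
      ⟨θ.toReal, ENNReal.toReal_nonneg,
        (ENNReal.ofReal_toReal (hθ.trans ENNReal.one_lt_top).ne).symm⟩
    have ht1 : t < 1 := ENNReal.ofReal_lt_one.1 hθ
    refine ⟨(1 - t) / 4, by linarith, ?_⟩
    rw [← ENNReal.ofReal_add (by linarith) (by linarith),
      ← ENNReal.ofReal_add (by linarith) (by linarith),
      ← ENNReal.ofReal_add (by linarith) (by linarith), ENNReal.ofReal_lt_one]
    linarith
  have hκpos : 0 < ENNReal.ofReal κ := ENNReal.ofReal_pos.2 hκ0
  have hδ : 0 < η / (3 * c) := by positivity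
  have hm : Tendsto (fun n : ℕ => ⌊c * (n : ℝ)⌋₊) atTop atTop :=
    tendsto_nat_floor_atTop.comp (tendsto_natCast_atTop_atTop.const_mul_atTop hc)
  have hconc := ((tendsto_ofReal_exp_neg_mul (c := (η / (3 * c)) ^ 2 / (2 * K ^ 2))
    (by positivity)).comp hm).eventually_le_const hκpos
  have hsmall := (tendsto_ofReal_exp_neg_mul (c := η / 3) (by positivity)).eventually_le_const
    hκpos
  filter_upwards [hconc, hsmall, hα.eventually_le_const hκpos, htail,
    coe_le_errorExponent_iff.1 hr (η / 3) (by positivity)] with n h1 h2 h3 h4 h5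
  by_contra! hlt
  have hfl : (⌊c * (n : ℝ)⌋₊ : ℝ) ≤ c * n := Nat.floor_le (by positivity)
  set m := ⌊c * (n : ℝ)⌋₊
  set s := ∑ k ∈ Finset.range m, ∫ x, logRatio N₀ N₁ x ∂((S n).roundLaw N₀ k)
  have hmδ : (m : ℝ) * (η / (3 * c)) ≤ n * (η / 3) := by
    calc (m : ℝ) * (η / (3 * c)) ≤ c * n * (η / (3 * c)) := by gcongr
      _ = n * (η / 3) := by field_simp
  have hmain := Strategy.one_le_exp_mul_acceptProb_add h hK (S n) m hij hδ.le
  have hprod : ENNReal.ofReal (Real.exp (s + m * (η / (3 * c)))) * (S n).acceptProb N₁ i ≤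
      ENNReal.ofReal κ := by
    refine le_trans ?_ h2
    calc _ ≤ ENNReal.ofReal (Real.exp (s + m * (η / (3 * c)))) *
          ENNReal.ofReal (Real.exp (-(n * (r - η / 3)))) := by gcongr
      _ ≤ _ := by
        rw [← ENNReal.ofReal_mul (Real.exp_pos _).le, ← Real.exp_add]
        refine ENNReal.ofReal_le_ofReal (Real.exp_le_exp.2 ?_)
        linarith
  exact absurd (hmain.trans (add_le_add (add_le_add (add_le_add hprod h1) h3) h4)) (not_le.2 hκ)

/-- The converse for both constraints: the running times only have to stay below `c * n`, for every
`c > 1`, with a probability bounded away from zero. -/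
theorem RatioBounded.mem_hull_of_tailProb (h : RatioBounded R K N₀ N₁) (hK : 0 < K)
    {S : ℕ → Strategy R A B} {r : ℝ × ℝ} (h1 : 0 ≤ r.1) (h2 : 0 ≤ r.2)
    (hS : HasExponents N₀ N₁ S r)
    (htail : ∀ c : ℝ, 1 < c → ∃ θ < (1 : ℝ≥0∞), ∀ᶠ n : ℕ in atTop,
      (S n).tailProb N₀ ⌊c * n⌋₊ ≤ θ ∧ (S n).tailProb N₁ ⌊c * n⌋₊ ≤ θ) :
    r ∈ closure (convexHull ℝ (rectangles R N₀ N₁)) := by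
  have key : ∀ η : ℝ, 0 < η → (max 0 ((r.1 - η) / (1 + η)), max 0 ((r.2 - η) / (1 + η))) ∈
      closure (convexHull ℝ (rectangles R N₀ N₁)) := by
    intro η hη
    obtain ⟨θ, hθ, ht⟩ := htail (1 + η) (by linarith)
    obtain ⟨⟨hα, hβ⟩, hr1, hr2⟩ := hS
    have e2 := h.eventually_exponent_le hK (i := 0) (j := 1) (by decide) (by linarith) hα hθ
      (ht.mono fun n hn => hn.1) hr2 hη
    have e1 := h.symm.eventually_exponent_le hK (i := 1) (j := 0) (by decide) (by linarith) hβ hθ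
      (ht.mono fun n hn => hn.2) hr1 hη
    obtain ⟨n, hn1, hn2, hn0⟩ := (e1.and (e2.and (eventually_gt_atTop 0))).exists
    have hn0' : (0 : ℝ) < n := by exact_mod_cast hn0
    set m := ⌊(1 + η) * (n : ℝ)⌋₊
    have hmn : (m : ℝ) ≤ (1 + η) * n := Nat.floor_le (by positivity)
    have hm : 0 < m := Nat.floor_pos.2 (by
      have : (1 : ℝ) ≤ n := by exact_mod_cast hn0
      nlinarith)
    have hm' : (0 : ℝ) < m := by exact_mod_cast hm
    have hle : ∀ t s : ℝ, 0 ≤ s → n * (t - η) ≤ s → max 0 ((t - η) / (1 + η)) ≤ s / m := by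
      intro t s hs hts
      refine max_le (by positivity) ?_
      rw [div_le_div_iff₀ (by linarith) hm']
      rcases le_total 0 (t - η) with h0 | h0
      · calc (t - η) * m ≤ (t - η) * ((1 + η) * n) := by gcongr
          _ = n * (t - η) * (1 + η) := by ring
          _ ≤ s * (1 + η) := by gcongr
      · exact (mul_nonpos_of_nonpos_of_nonneg h0 hm'.le).trans (by positivity)
    have hnonneg : ∀ M₀ M₁ : QChannel A B, RatioBounded R K M₀ M₁ →
        0 ≤ ∑ k ∈ Finset.range m, ∫ x, logRatio M₀ M₁ x ∂((S n).roundLaw M₀ k) :=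
      fun M₀ M₁ hM => Finset.sum_nonneg fun k _ => by
        rw [hM.integral_logRatio hK.le]
        exact integral_nonneg fun x => hM.relEnt_nonneg x
    exact mem_closure_convexHull_rectangles_of_le (h.average_relEnt_mem hK.le (S n) hm)
      (le_max_left _ _) (le_max_left _ _) (hle _ _ (hnonneg _ _ h.symm) hn1)
      (hle _ _ (hnonneg _ _ h) hn2)
  have hlim : Tendsto (fun η : ℝ => (max 0 ((r.1 - η) / (1 + η)), max 0 ((r.2 - η) / (1 + η))))
      (nhdsWithin 0 (Set.Ioi 0)) (nhds r) := by
    have hcont : ∀ t : ℝ, 0 ≤ t → Tendsto (fun η : ℝ => max 0 ((t - η) / (1 + η)))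
        (nhdsWithin 0 (Set.Ioi 0)) (nhds t) := by
      intro t ht
      have : ContinuousAt (fun η : ℝ => max 0 ((t - η) / (1 + η))) 0 :=
        continuousAt_const.max (ContinuousAt.div (by fun_prop) (by fun_prop) (by norm_num))
      have h0 := this.tendsto.mono_left (nhdsWithin_le_nhds (s := Set.Ioi 0))
      simpa [ht] using h0
    exact (hcont _ h1).prodMk_nhds (hcont _ h2)
  exact isClosed_closure.mem_of_tendsto hlim (eventually_nhdsWithin_of_forall key)

theorem Strategy.tailProb_anti (S : Strategy R A B) (N : QChannel A B) {m n : ℕ} (hmn : m ≤ n) :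
    S.tailProb N n ≤ S.tailProb N m := by
  refine measure_mono fun ω (hω : (n : ℕ∞) < S.stopTime ω) => ?_
  exact lt_of_le_of_lt (Nat.cast_le.2 hmn) hω

/-- Markov's inequality for the running time. -/
theorem Strategy.mul_tailProb_le_expectedTime (S : Strategy R A B) (N : QChannel A B) (m : ℕ) :
    ((m + 1 : ℕ) : ℝ≥0∞) * S.tailProb N m ≤ S.expectedTime N := by
  rw [tailProb, ← lintegral_indicator_const (S.measurableSet_lt_stopTime m)]
  refine lintegral_mono fun ω => ?_
  by_cases hω : ω ∈ {ω | (m : ℕ∞) < S.stopTime ω}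
  · rw [Set.indicator_of_mem hω]
    have h := ENat.toENNReal_le.2 ((ENat.add_one_le_iff (ENat.natCast_ne_top m)).2 hω)
    simpa using h
  · rw [Set.indicator_of_notMem hω]
    exact zero_le

theorem RatioBounded.regionP_subset (h : RatioBounded R K N₀ N₁) (hK : 0 < K) {ε : ℝ}
    (hε : ε < 1) : regionP R ε N₀ N₁ ⊆ closure (convexHull ℝ (rectangles R N₀ N₁)) := by
  rintro r ⟨h1, h2, S, hS, hlim⟩
  refine h.mem_hull_of_tailProb hK h1 h2 hS fun c hc => ?_
  refine ⟨ENNReal.ofReal ε, ENNReal.ofReal_lt_one.2 hε, ?_⟩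
  filter_upwards [eventually_lt_of_limsup_lt hlim] with n hn
  have hle : n ≤ ⌊c * (n : ℝ)⌋₊ := Nat.le_floor (le_mul_of_one_le_left (Nat.cast_nonneg n) hc.le)
  exact ⟨((S n).tailProb_anti N₀ hle).trans ((le_max_left _ _).trans hn.le),
    ((S n).tailProb_anti N₁ hle).trans ((le_max_right _ _).trans hn.le)⟩

theorem RatioBounded.regionE_subset (h : RatioBounded R K N₀ N₁) (hK : 0 < K) :
    regionE R N₀ N₁ ⊆ closure (convexHull ℝ (rectangles R N₀ N₁)) := by
  rintro r ⟨h1, h2, S, hS, hlim⟩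
  refine h.mem_hull_of_tailProb hK h1 h2 hS fun c hc => ?_
  obtain ⟨d, hd1, hdc⟩ := exists_between hc
  have hc0 : 0 < c := one_pos.trans hc
  refine ⟨ENNReal.ofReal (d / c), ENNReal.ofReal_lt_one.2 ((div_lt_one hc0).2 hdc), ?_⟩
  have hlt := eventually_lt_of_limsup_lt (lt_of_le_of_lt hlim (zero_lt_one (α := EReal)))
  have hlarge : ∀ᶠ n : ℕ in atTop, 1 ≤ (d - 1) * (n : ℝ) :=
    (tendsto_natCast_atTop_atTop.const_mul_atTop (by linarith : 0 < d - 1)).eventually_ge_atTop 1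
  filter_upwards [hlt, hlarge, eventually_gt_atTop 0] with n hn hn1 hn0
  have hn0' : (0 : ℝ) < n := by exact_mod_cast hn0
  set m := ⌊c * (n : ℝ)⌋₊
  have hm : c * n ≤ ((m + 1 : ℕ) : ℝ) := by
    push_cast
    exact (Nat.lt_floor_add_one _).le
  have hT : max ((S n).expectedTime N₀) ((S n).expectedTime N₁) ≤ ENNReal.ofReal (d * n) := by
    have hn2 := EReal.sub_lt_iff (Or.inl (EReal.natCast_ne_bot n))
      (Or.inl (EReal.natCast_ne_top n)) |>.1 hn
    have hn3 : (1 : EReal) + (n : EReal) ≤ ((ENNReal.ofReal (d * n) : ℝ≥0∞) : EReal) := by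
      rw [EReal.coe_ennreal_ofReal, max_eq_left (by nlinarith), ← EReal.coe_natCast,
        ← EReal.coe_one, ← EReal.coe_add, EReal.coe_le_coe_iff]
      linarith
    exact EReal.coe_ennreal_le_coe_ennreal_iff.1 (hn2.le.trans hn3)
  have hbound : ∀ N : QChannel A B, (S n).expectedTime N ≤ ENNReal.ofReal (d * n) →
      (S n).tailProb N m ≤ ENNReal.ofReal (d / c) := by
    intro N hN
    have h3 := ((S n).mul_tailProb_le_expectedTime N m).trans hN
    have h4 : ENNReal.ofReal (c * n) * (S n).tailProb N m ≤ ENNReal.ofReal (d * n) := by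
      refine le_trans ?_ h3
      gcongr
      rw [← ENNReal.ofReal_natCast]
      exact ENNReal.ofReal_le_ofReal hm
    have h5 : ENNReal.ofReal (d * n) = ENNReal.ofReal (c * n) * ENNReal.ofReal (d / c) := by
      rw [← ENNReal.ofReal_mul (by positivity)]
      congr 1
      field_simp
    rw [h5] at h4
    exact (ENNReal.mul_le_mul_iff_right (ENNReal.ofReal_pos.2 (by positivity)).ne'
      ENNReal.ofReal_ne_top).1 h4
  exact ⟨hbound N₀ ((le_max_left _ _).trans hT), hbound N₁ ((le_max_right _ _).trans hT)⟩

end Region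

section Achievability

variable [Fintype R] [Fintype A] [Fintype B] [DecidableEq R] [DecidableEq B] {q : ℕ}
  {N₀ N₁ : QChannel A B} {K : ℝ}

/-! ### Mixtures of measurements -/

/-- The POVM obtained by applying `f` to the outcome. -/
def POVM.relabel {H : Type*} [Fintype H] [DecidableEq H] {q q' : ℕ} (f : Fin q → Fin q')
    (m : POVM H q) : POVM H q' :=
  ⟨fun y' => ∑ y with f y = y', m.1 y,
    fun _ => Matrix.posSemidef_sum _ fun y _ => m.2.1 y, by
      rw [Finset.sum_fiberwise, m.2.2]⟩

theorem POVM.measurable_relabel {H : Type*} [Fintype H] [DecidableEq H] {q q' : ℕ}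
    (f : Fin q → Fin q') : Measurable (POVM.relabel f : POVM H q → POVM H q') := by
  refine Continuous.measurable (Continuous.subtype_mk (continuous_pi fun y' => ?_) _)
  exact continuous_finsetSum _ fun y _ => (continuous_apply y).comp continuous_subtype_val

theorem outcomeProb_relabel {q' : ℕ} (N : QChannel A B) (ρ : State (R × A)) (m : POVM (R × B) q)
    (f : Fin q → Fin q') (y' : Fin q') :
    outcomeProb N ρ (m.relabel f) y' = ∑ y with f y = y', outcomeProb N ρ m y := by
  simp only [outcomeProb, POVM.relabel, Finset.mul_sum, Matrix.trace_sum, Complex.re_sum]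

theorem relEnt_relabel {q' : ℕ} (N₀ N₁ : QChannel A B) {f : Fin q → Fin q'}
    (hf : Function.Injective f) (x : State (R × A) × POVM (R × B) q) :
    relEnt N₀ N₁ (x.1, x.2.relabel f) = relEnt N₀ N₁ x := by
  have h1 : ∀ (N : QChannel A B) (y : Fin q),
      outcomeProb N x.1 (x.2.relabel f) (f y) = outcomeProb N x.1 x.2 y := by
    intro N y
    rw [outcomeProb_relabel]
    simp only [hf.eq_iff, Finset.filter_eq', Finset.mem_univ, if_true, Finset.sum_singleton]
  refine (Fintype.sum_of_injective f hf _ _ (fun y' hy' => ?_) fun y => ?_).symm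
  · rw [outcomeProb_relabel, Finset.sum_eq_zero, zero_mul]
    intro y hy
    exact absurd ⟨y, (Finset.mem_filter.1 hy).2⟩ hy'
  · simp only [logRatio, h1]

/-- Every point of the convex hull is dominated by the pair of mean relative entropies of a random
choice of input state and POVM. -/
theorem RatioBounded.exists_integral_relEnt_ge (h : RatioBounded R K N₀ N₁) (hK : 0 ≤ K)
    {r : ℝ × ℝ} (hr : r ∈ convexHull ℝ (rectangles R N₀ N₁)) :
    ∃ (q : ℕ) (ν : ProbabilityMeasure (State (R × A) × POVM (R × B) q)),
      r.1 ≤ ∫ x, relEnt N₁ N₀ x ∂(ν : Measure (State (R × A) × POVM (R × B) q)) ∧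
      r.2 ≤ ∫ x, relEnt N₀ N₁ x ∂(ν : Measure (State (R × A) × POVM (R × B) q)) := by
  suffices hsub : convexHull ℝ (rectangles R N₀ N₁) ⊆
      {r : ℝ × ℝ | ∃ (q : ℕ) (ν : ProbabilityMeasure (State (R × A) × POVM (R × B) q)),
        r.1 ≤ ∫ x, relEnt N₁ N₀ x ∂(ν : Measure (State (R × A) × POVM (R × B) q)) ∧
        r.2 ≤ ∫ x, relEnt N₀ N₁ x ∂(ν : Measure (State (R × A) × POVM (R × B) q))} from hsub hr
  refine convexHull_min ?_ ?_
  · rintro r ⟨-, -, ρ, q, m, h1, h2⟩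
    refine ⟨q, ⟨Measure.dirac (ρ, m), inferInstance⟩, ?_, ?_⟩
    · rw [ProbabilityMeasure.coe_mk,
        integral_dirac' _ _ (measurable_relEnt N₁ N₀).stronglyMeasurable]
      exact (h.symm.ofReal_le_klDiv_iff ρ m).1 h1
    · rw [ProbabilityMeasure.coe_mk,
        integral_dirac' _ _ (measurable_relEnt N₀ N₁).stronglyMeasurable]
      exact (h.ofReal_le_klDiv_iff ρ m).1 h2
  · rintro r ⟨q, ν, h1, h2⟩ r' ⟨q', ν', h1', h2'⟩ s t hs ht hst
    let φ : State (R × A) × POVM (R × B) q → State (R × A) × POVM (R × B) (q + q') :=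
      Prod.map id (POVM.relabel (Fin.castAdd q'))
    let φ' : State (R × A) × POVM (R × B) q' → State (R × A) × POVM (R × B) (q + q') :=
      Prod.map id (POVM.relabel (Fin.natAdd q))
    have hφ : Measurable φ := measurable_id.prodMap (POVM.measurable_relabel _)
    have hφ' : Measurable φ' := measurable_id.prodMap (POVM.measurable_relabel _)
    let μ : Measure (State (R × A) × POVM (R × B) (q + q')) :=
      ENNReal.ofReal s • (ν : Measure _).map φ + ENNReal.ofReal t • (ν' : Measure _).map φ'
    have i1 : IsProbabilityMeasure ((ν : Measure _).map φ) :=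
      Measure.isProbabilityMeasure_map hφ.aemeasurable
    have i2 : IsProbabilityMeasure ((ν' : Measure _).map φ') :=
      Measure.isProbabilityMeasure_map hφ'.aemeasurable
    have hμ : IsProbabilityMeasure μ := ⟨by
      simp only [μ, Measure.add_apply, Measure.smul_apply, smul_eq_mul, measure_univ, mul_one]
      rw [← ENNReal.ofReal_add hs ht, hst, ENNReal.ofReal_one]⟩
    have hint : ∀ M₀ M₁ : QChannel A B, RatioBounded R K M₀ M₁ →
        ∫ x, relEnt M₀ M₁ x ∂μ =
          s * ∫ x, relEnt M₀ M₁ x ∂(ν : Measure (State (R × A) × POVM (R × B) q)) +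
          t * ∫ x, relEnt M₀ M₁ x ∂(ν' : Measure (State (R × A) × POVM (R × B) q')) := by
      intro M₀ M₁ hM
      rw [integral_add_measure
          ((hM.integrable_relEnt hK ((ν : Measure _).map φ)).smul_measure ENNReal.ofReal_ne_top)
          ((hM.integrable_relEnt hK ((ν' : Measure _).map φ')).smul_measure
            ENNReal.ofReal_ne_top),
        integral_smul_measure, integral_smul_measure, ENNReal.toReal_ofReal hs,
        ENNReal.toReal_ofReal ht,
        integral_map hφ.aemeasurable (measurable_relEnt M₀ M₁).aestronglyMeasurable,
        integral_map hφ'.aemeasurable (measurable_relEnt M₀ M₁).aestronglyMeasurable]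
      have e1 : ∀ x, relEnt M₀ M₁ (φ x) = relEnt M₀ M₁ x :=
        relEnt_relabel M₀ M₁ (Fin.castAdd_injective q q')
      have e2 : ∀ x, relEnt M₀ M₁ (φ' x) = relEnt M₀ M₁ x :=
        relEnt_relabel M₀ M₁ (Fin.natAdd_injective q' q)
      simp only [e1, e2, smul_eq_mul]
    refine ⟨q + q', ⟨μ, hμ⟩, ?_, ?_⟩
    · rw [ProbabilityMeasure.coe_mk, hint _ _ h.symm]
      exact add_le_add (mul_le_mul_of_nonneg_left h1 hs) (mul_le_mul_of_nonneg_left h1' ht)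
    · rw [ProbabilityMeasure.coe_mk, hint _ _ h]
      exact add_le_add (mul_le_mul_of_nonneg_left h2 hs) (mul_le_mul_of_nonneg_left h2' ht)

/-! ### Sequential probability ratio tests -/

namespace Strategy

/-- Change of measure at the stopping time: if hypothesis `i` is accepted only when the
log-likelihood ratio against `N₁` has reached `a`, then it is accepted under `N₁` with probability
at most `exp (-a)`. -/
theorem acceptProb_le_exp_neg (h : RatioBounded R K N₀ N₁) (S : Strategy R A B) {i : Fin 2} {a : ℝ}
    (ha : ∀ ω k, S.decision ω k = some i →
      a ≤ ∑ l ∈ Finset.range (k + 1), logRatio N₀ N₁ (ω l)) :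
    S.acceptProb N₁ i ≤ ENNReal.ofReal (Real.exp (-a)) := by
  let E : ℕ → Set (ℕ → Round R A B S.q) := fun k =>
    {ω | S.decision ω k = some i} ∩ ⋂ j < k, {ω | S.decision ω j = none}
  have hE : ∀ k, MeasurableSet[pastSigma (Round R A B S.q) (k + 1)] (E k) := fun k =>
    MeasurableSet.inter (S.measurableSet_decision_eq (Nat.lt_succ_self k) _)
      (MeasurableSet.iInter fun j => MeasurableSet.iInter fun hj =>
        S.measurableSet_decision_eq (hj.trans (Nat.lt_succ_self k)) _)
  have hacc : S.accepts i = ⋃ k, E k := by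
    ext ω
    simp [accepts, E]
  have hdisj : Pairwise (Function.onFun Disjoint E) := by
    refine (pairwise_disjoint_on E).2 fun j k hjk => Set.disjoint_left.2 fun ω hj hk => ?_
    have h1 : S.decision ω j = some i := hj.1
    have h2 : S.decision ω j = none := by
      have := hk.2
      simp only [Set.mem_iInter] at this
      exact this j hjk
    rw [h1] at h2
    cases h2
  calc S.acceptProb N₁ i ≤ ∑' k, S.law N₁ (E k) := by
        rw [acceptProb, hacc]
        exact measure_iUnion_le E
    _ ≤ ∑' k, ENNReal.ofReal (Real.exp (-a)) * S.law N₀ (E k) := by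
        refine ENNReal.tsum_le_tsum fun k => ?_
        refine infinitePi_le_exp_mul (P := S.roundLaw N₁) (Q := S.roundLaw N₀)
          (measurable_logRatio N₁ N₀) (h.symm.roundLaw_eq_withDensity S) (hE k) fun ω hω => ?_
        simp only [logRatio_swap N₀ N₁, Finset.sum_neg_distrib]
        exact neg_le_neg (ha ω k hω.1)
    _ = ENNReal.ofReal (Real.exp (-a)) * S.law N₀ (⋃ k, E k) := by
        rw [ENNReal.tsum_mul_left, measure_iUnion hdisj fun k => pastSigma_le _ _ (hE k)]
    _ ≤ ENNReal.ofReal (Real.exp (-a)) * 1 := by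
        gcongr
        exact prob_le_one
    _ = ENNReal.ofReal (Real.exp (-a)) := mul_one _

theorem expectedTime_le_tsum_tailProb (S : Strategy R A B) (N : QChannel A B) :
    S.expectedTime N ≤ ∑' k : ℕ, S.tailProb N k := by
  have h1 : ∀ k : ℕ, S.tailProb N k =
      ∫⁻ ω, {ω | (k : ℕ∞) < S.stopTime ω}.indicator (fun _ => 1) ω ∂(S.law N) := fun k => by
    rw [lintegral_indicator_const (S.measurableSet_lt_stopTime k), one_mul, tailProb]
  simp only [h1]
  rw [← lintegral_tsum fun k =>
    (measurable_const.indicator (S.measurableSet_lt_stopTime k)).aemeasurable]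
  refine lintegral_mono fun ω => ?_
  have hind : ∀ k : ℕ, (k : ℕ∞) < S.stopTime ω →
      {ω | (k : ℕ∞) < S.stopTime ω}.indicator (fun _ => (1 : ℝ≥0∞)) ω = 1 := fun k hk => by
    rw [Set.indicator_of_mem (show ω ∈ {ω | (k : ℕ∞) < S.stopTime ω} from hk)]
  induction hT : S.stopTime ω with
  | top =>
    have h2 : ∀ k : ℕ, {ω | (k : ℕ∞) < S.stopTime ω}.indicator (fun _ => (1 : ℝ≥0∞)) ω = 1 :=
      fun k => hind k (by simp [hT])
    simp only [h2, ENNReal.tsum_const_eq_top_of_ne_zero one_ne_zero, le_top]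
  | coe m =>
    have h2 : ∀ k ∈ Finset.range m,
        {ω | (k : ℕ∞) < S.stopTime ω}.indicator (fun _ => (1 : ℝ≥0∞)) ω = 1 := fun k hk =>
      hind k (by
        rw [hT]
        exact_mod_cast Finset.mem_range.1 hk)
    calc ((m : ℕ∞) : ℝ≥0∞) = ∑ k ∈ Finset.range m,
          {ω | (k : ℕ∞) < S.stopTime ω}.indicator (fun _ => (1 : ℝ≥0∞)) ω := by
          rw [Finset.sum_congr rfl h2]
          simp
      _ ≤ _ := ENNReal.sum_le_tsum _

/-- If the test stops as soon as the log-likelihood ratio exceeds `a`, then its running time has an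
exponential tail from the time on at which the mean of the ratio has passed `a`. -/
theorem tailProb_le_exp (h : RatioBounded R K N₀ N₁) (hK : 0 < K) (S : Strategy R A B) {a d : ℝ}
    (ha : ∀ ω k, S.decision ω k = none →
      ∑ l ∈ Finset.range (k + 1), logRatio N₀ N₁ (ω l) ≤ a)
    (hd : ∀ k, ∫ x, relEnt N₀ N₁ x ∂(S.ν k : Measure (State (R × A) × POVM (R × B) S.q)) = d)
    {k : ℕ} (hk : 0 < k) {δ : ℝ} (hδ : 0 ≤ δ) (hak : a ≤ k * (d - δ)) :
    S.tailProb N₀ k ≤ ENNReal.ofReal (Real.exp (-(δ ^ 2 / (2 * K ^ 2)) * k)) := by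
  refine (measure_mono fun ω hω => ?_).trans (infinitePi_sum_le_le (P := S.roundLaw N₀)
    (measurable_logRatio N₀ N₁) hK (h.abs_logRatio_le hK.le) k hδ)
  have hnone := (S.lt_stopTime_iff k ω).1 hω (k - 1) (by omega)
  have h1 := ha ω (k - 1) hnone
  rw [Nat.sub_add_cancel hk] at h1
  simp only [Set.mem_ofPred_eq, h.integral_logRatio hK.le, hd, Finset.sum_const, Finset.card_range, nsmul_eq_mul]
  linarith

/-- Tests that stop when the log-likelihood ratio exceeds `t * n`, with `t` below the mean `d` of
the ratio per round, use fewer than `n` rounds in the mean. -/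
theorem eventually_expectedTime_le (h : RatioBounded R K N₀ N₁) (hK : 0 < K)
    {S : ℕ → Strategy R A B} {t d : ℝ} (ht : 0 < t) (htd : t < d)
    (ha : ∀ n ω k, (S n).decision ω k = none →
      ∑ l ∈ Finset.range (k + 1), logRatio N₀ N₁ (ω l) ≤ n * t)
    (hd : ∀ n k, ∫ x, relEnt N₀ N₁ x
      ∂((S n).ν k : Measure (State (R × A) × POVM (R × B) (S n).q)) = d) :
    (∀ᶠ n : ℕ in atTop, (S n).expectedTime N₀ ≤ n) ∧
      Tendsto (fun n => (S n).tailProb N₀ n) atTop (nhds 0) := by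
  have hd0 : 0 < d := ht.trans htd
  -- From round `s * n` on, the mean of the ratio exceeds `t * n` by a fixed amount per round.
  obtain ⟨s, hs1, hs2⟩ := exists_between ((div_lt_one hd0).2 htd)
  have hs0 : 0 < s := (div_pos ht hd0).trans hs1
  set δ := d - t / s with hδdef
  have hδ : 0 < δ := by
    rw [div_lt_iff₀ hd0] at hs1
    rw [hδdef, sub_pos, div_lt_iff₀ hs0]
    linarith
  set c := δ ^ 2 / (2 * K ^ 2)
  have hc : 0 < c := by positivity
  have hak : ∀ n k : ℕ, s * n ≤ k → n * t ≤ k * (d - δ) := by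
    intro n k hnk
    rw [hδdef, sub_sub_cancel, mul_div_assoc', le_div_iff₀ hs0]
    nlinarith
  have htail : ∀ n k : ℕ, 0 < k → s * n ≤ k →
      (S n).tailProb N₀ k ≤ ENNReal.ofReal (Real.exp (-c * k)) := fun n k hk hnk =>
    tailProb_le_exp h hK (S n) (ha n) (hd n) hk hδ.le (hak n k hnk)
  constructor
  · set G : ℝ≥0∞ := ∑' k : ℕ, ENNReal.ofReal (Real.exp (-c * k)) with hG
    have hGtop : G ≠ ⊤ := by
      have hsum : Summable fun k : ℕ => Real.exp (-c * k) := by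
        simpa only [mul_comm] using Real.summable_exp_nat_mul_iff.2 (neg_lt_zero.2 hc)
      exact hsum.tsum_ofReal_ne_top
    have hlarge : ∀ᶠ n : ℕ in atTop, 2 + G.toReal ≤ (1 - s) * (n : ℝ) :=
      (tendsto_natCast_atTop_atTop.const_mul_atTop (by linarith : 0 < 1 - s)).eventually_ge_atTop _
    filter_upwards [hlarge] with n hn
    set m := ⌈s * (n : ℝ)⌉₊ + 1
    have hm : (m : ℝ) ≤ s * n + 2 := by
      have := (Nat.ceil_lt_add_one (show 0 ≤ s * (n : ℝ) by positivity)).le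
      simp only [m]
      push_cast
      linarith
    have hpt : ∀ k : ℕ, (S n).tailProb N₀ k ≤
        (if k ∈ Finset.range m then 1 else 0) + ENNReal.ofReal (Real.exp (-c * k)) := by
      intro k
      by_cases hk : k < m
      · rw [if_pos (Finset.mem_range.2 hk)]
        exact prob_le_one.trans le_self_add
      · have hk' : ⌈s * (n : ℝ)⌉₊ + 1 ≤ k := not_lt.1 hk
        have hk2 : s * (n : ℝ) ≤ k := (Nat.le_ceil _).trans (by exact_mod_cast (by omega))
        exact (htail n k (by omega) hk2).trans le_add_self
    calc (S n).expectedTime N₀ ≤ ∑' k : ℕ, (S n).tailProb N₀ k :=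
          (S n).expectedTime_le_tsum_tailProb N₀
      _ ≤ ∑' k : ℕ, ((if k ∈ Finset.range m then 1 else 0) +
            ENNReal.ofReal (Real.exp (-c * k))) := ENNReal.tsum_le_tsum hpt
      _ = m + G := by
          rw [ENNReal.tsum_add, tsum_eq_sum (s := Finset.range m) fun k hk => if_neg hk,
            Finset.sum_congr rfl fun k hk => if_pos hk]
          simp [hG]
      _ ≤ n := by
          rw [← ENNReal.ofReal_toReal hGtop, ← ENNReal.ofReal_natCast, ← ENNReal.ofReal_natCast n,
            ← ENNReal.ofReal_add (Nat.cast_nonneg m) ENNReal.toReal_nonneg]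
          exact ENNReal.ofReal_le_ofReal (by linarith)
  · refine tendsto_of_tendsto_of_tendsto_of_le_of_le' tendsto_const_nhds
      (tendsto_ofReal_exp_neg_mul hc) (Eventually.of_forall fun _ => zero_le) ?_
    filter_upwards [eventually_gt_atTop 0] with n hn
    exact htail n n hn (mul_le_of_le_one_left (Nat.cast_nonneg n) hs2.le)

/-- The sequential probability ratio test: in every round the input state and the POVM are drawn
from `ν`; hypothesis `0` is accepted when the accumulated log-likelihood ratio reaches `a`, and
hypothesis `1` when it falls to `-b`. -/
def sprt (N₀ N₁ : QChannel A B) (ν : ProbabilityMeasure (State (R × A) × POVM (R × B) q))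
    (a b : ℝ) : Strategy R A B where
  q := q
  ν _ := ν
  d k x := if a ≤ ∑ i, logRatio N₀ N₁ (x i) then some 0 else
    if ∑ i, logRatio N₀ N₁ (x i) ≤ -b then some 1 else none
  measurable_d k c := by
    have hm : Measurable fun x : Fin (k + 1) → Round R A B q => ∑ i, logRatio N₀ N₁ (x i) :=
      Finset.measurable_sum _ fun i _ => (measurable_logRatio N₀ N₁).comp (measurable_pi_apply i)
    let _ : MeasurableSpace (Option (Fin 2)) := ⊤
    exact (Measurable.ite (hm measurableSet_Ici) measurable_const
      (Measurable.ite (hm measurableSet_Iic) measurable_const measurable_const))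
      (MeasurableSpace.measurableSet_top (s := {c}))

variable {ν : ProbabilityMeasure (State (R × A) × POVM (R × B) q)} {a b : ℝ} {k : ℕ}
  {ω : ℕ → Round R A B (sprt N₀ N₁ ν a b).q}

theorem sprt_decision : (sprt N₀ N₁ ν a b).decision ω k =
    if a ≤ ∑ i ∈ Finset.range (k + 1), logRatio N₀ N₁ (ω i) then some 0 else
      if ∑ i ∈ Finset.range (k + 1), logRatio N₀ N₁ (ω i) ≤ -b then some 1 else none := by
  rw [← Fin.sum_univ_eq_sum_range (fun i => logRatio N₀ N₁ (ω i)) (k + 1)]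
  rfl

theorem sum_logRatio_le_of_sprt_decision_eq_none (h : (sprt N₀ N₁ ν a b).decision ω k = none) :
    ∑ i ∈ Finset.range (k + 1), logRatio N₀ N₁ (ω i) ≤ a ∧
      ∑ i ∈ Finset.range (k + 1), logRatio N₁ N₀ (ω i) ≤ b := by
  simp only [logRatio_swap N₀ N₁, Finset.sum_neg_distrib]
  rw [sprt_decision] at h
  split_ifs at h
  constructor <;> linarith

theorem le_sum_logRatio_of_sprt_decision_eq_zero
    (h : (sprt N₀ N₁ ν a b).decision ω k = some 0) :
    a ≤ ∑ i ∈ Finset.range (k + 1), logRatio N₀ N₁ (ω i) := by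
  rw [sprt_decision] at h
  split_ifs at h with hle
  · exact hle
  · simp at h

theorem le_sum_logRatio_of_sprt_decision_eq_one
    (h : (sprt N₀ N₁ ν a b).decision ω k = some 1) :
    b ≤ ∑ i ∈ Finset.range (k + 1), logRatio N₁ N₀ (ω i) := by
  simp only [logRatio_swap N₀ N₁, Finset.sum_neg_distrib]
  rw [sprt_decision] at h
  split_ifs at h with hle hle2
  · simp at h
  · linarith

end Strategy

end Achievability

/-! ### Achievability -/

/-- Diagonalization: a property with a tolerance that can be met eventually for every tolerance is
met along one sequence for all tolerances. -/
theorem exists_seq_eventually_of_tolerance {α : Type*} [Nonempty α] {p : ℝ → ℕ → α → Prop}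
    (hmono : ∀ δ δ' n a, δ ≤ δ' → p δ n a → p δ' n a)
    (h : ∀ δ > 0, ∀ᶠ n in atTop, ∃ a, p δ n a) :
    ∃ a : ℕ → α, ∀ δ > 0, ∀ᶠ n in atTop, p δ n (a n) := by
  classical
  let Q : ℕ → ℕ → Prop := fun n k => ∃ a, p (1 / ((k : ℝ) + 1)) n a
  -- At index `n`, the smallest tolerance `1 / (k + 1)` with `k ≤ n` that can be met is used.
  have hchoice : ∀ n, ∃ a, Q n (Nat.findGreatest (Q n) n) →
      p (1 / ((Nat.findGreatest (Q n) n : ℝ) + 1)) n a := by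
    intro n
    by_cases hQ : Q n (Nat.findGreatest (Q n) n)
    · obtain ⟨a, ha⟩ := hQ
      exact ⟨a, fun _ => ha⟩
    · exact ⟨Classical.arbitrary α, fun h => absurd h hQ⟩
  choose a ha using hchoice
  refine ⟨a, fun δ hδ => ?_⟩
  obtain ⟨k, hk⟩ := exists_nat_one_div_lt hδ
  filter_upwards [h (1 / ((k : ℝ) + 1)) Nat.one_div_pos_of_nat, eventually_ge_atTop k]
    with n hn hkn
  refine hmono _ _ _ _ (le_trans ?_ hk.le) (ha n (Nat.findGreatest_spec hkn hn))
  exact Nat.one_div_le_one_div (Nat.le_findGreatest hkn hn)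

section Regions

variable [Fintype R] [Fintype A] [Fintype B] [DecidableEq R] [DecidableEq B] {q : ℕ}
  {N₀ N₁ : QChannel A B} {K : ℝ}

/-- The strategy `S` has budget `n` in the mean and, up to the tolerance `δ`, meets all further
requirements on a strategy achieving the exponents `r`. -/
structure Strategy.IsGood (N₀ N₁ : QChannel A B) (r : ℝ × ℝ) (δ : ℝ) (n : ℕ)
    (S : Strategy R A B) : Prop where
  expectedTime_fst : S.expectedTime N₀ ≤ n
  expectedTime_snd : S.expectedTime N₁ ≤ n
  tailProb_fst : S.tailProb N₀ n ≤ ENNReal.ofReal δ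
  tailProb_snd : S.tailProb N₁ n ≤ ENNReal.ofReal δ
  acceptProb_fst : S.acceptProb N₀ 1 ≤ ENNReal.ofReal δ
  acceptProb_snd : S.acceptProb N₁ 0 ≤ ENNReal.ofReal δ
  exponent_fst : S.acceptProb N₀ 1 ≤ ENNReal.ofReal (Real.exp (-(n * (r.1 - δ))))
  exponent_snd : S.acceptProb N₁ 0 ≤ ENNReal.ofReal (Real.exp (-(n * (r.2 - δ))))

theorem Strategy.IsGood.mono {r : ℝ × ℝ} {δ δ' : ℝ} {n : ℕ} {S : Strategy R A B}
    (h : S.IsGood N₀ N₁ r δ n) (hδ : δ ≤ δ') : S.IsGood N₀ N₁ r δ' n := by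
  have h1 := ENNReal.ofReal_le_ofReal hδ
  have h2 : ∀ s : ℝ, ENNReal.ofReal (Real.exp (-(n * (s - δ)))) ≤
      ENNReal.ofReal (Real.exp (-(n * (s - δ')))) := fun s => by gcongr
  exact ⟨h.1, h.2, h.3.trans h1, h.4.trans h1, h.5.trans h1, h.6.trans h1, h.7.trans (h2 _),
    h.8.trans (h2 _)⟩

theorem RatioBounded.eventually_sprt_isGood (h : RatioBounded R K N₀ N₁) (hK : 0 < K)
    (ν : ProbabilityMeasure (State (R × A) × POVM (R × B) q)) {t r : ℝ × ℝ} {δ : ℝ} (hδ : 0 < δ)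
    (h1 : 0 < t.1) (h2 : 0 < t.2)
    (ht1 : t.1 < ∫ x, relEnt N₁ N₀ x ∂(ν : Measure (State (R × A) × POVM (R × B) q)))
    (ht2 : t.2 < ∫ x, relEnt N₀ N₁ x ∂(ν : Measure (State (R × A) × POVM (R × B) q)))
    (hr1 : r.1 - δ ≤ t.1) (hr2 : r.2 - δ ≤ t.2) :
    ∀ᶠ n : ℕ in atTop, (Strategy.sprt N₀ N₁ ν (n * t.2) (n * t.1)).IsGood N₀ N₁ r δ n := by
  obtain ⟨hE0, hP0⟩ := Strategy.eventually_expectedTime_le h hK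
    (S := fun n : ℕ => Strategy.sprt N₀ N₁ ν (n * t.2) (n * t.1)) h2 ht2
    (fun n ω k hd => (Strategy.sum_logRatio_le_of_sprt_decision_eq_none hd).1) (fun _ _ => rfl)
  obtain ⟨hE1, hP1⟩ := Strategy.eventually_expectedTime_le h.symm hK
    (S := fun n : ℕ => Strategy.sprt N₀ N₁ ν (n * t.2) (n * t.1)) h1 ht1
    (fun n ω k hd => (Strategy.sum_logRatio_le_of_sprt_decision_eq_none hd).2) (fun _ _ => rfl)
  have hA0 : ∀ n : ℕ, (Strategy.sprt N₀ N₁ ν (n * t.2) (n * t.1)).acceptProb N₁ 0 ≤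
      ENNReal.ofReal (Real.exp (-(n * t.2))) := fun n =>
    Strategy.acceptProb_le_exp_neg h _ fun ω k hd =>
      Strategy.le_sum_logRatio_of_sprt_decision_eq_zero hd
  have hA1 : ∀ n : ℕ, (Strategy.sprt N₀ N₁ ν (n * t.2) (n * t.1)).acceptProb N₀ 1 ≤
      ENNReal.ofReal (Real.exp (-(n * t.1))) := fun n =>
    Strategy.acceptProb_le_exp_neg h.symm _ fun ω k hd =>
      Strategy.le_sum_logRatio_of_sprt_decision_eq_one hd
  have hsmall : ∀ s : ℝ, 0 < s → ∀ᶠ n : ℕ in atTop,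
      ENNReal.ofReal (Real.exp (-(n * s))) ≤ ENNReal.ofReal δ := fun s hs => by
    filter_upwards [(tendsto_ofReal_exp_neg_mul hs).eventually_le_const
      (ENNReal.ofReal_pos.2 hδ)] with n hn
    rwa [mul_comm, ← neg_mul]
  have hexp : ∀ (n : ℕ) (s s' : ℝ), s - δ ≤ s' → ENNReal.ofReal (Real.exp (-(n * s'))) ≤
      ENNReal.ofReal (Real.exp (-(n * (s - δ)))) := fun n s s' hs => by gcongr
  filter_upwards [hE0, hE1, hP0.eventually_le_const (ENNReal.ofReal_pos.2 hδ),
    hP1.eventually_le_const (ENNReal.ofReal_pos.2 hδ), hsmall _ h1, hsmall _ h2]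
    with n e0 e1 p0 p1 s1 s2
  exact ⟨e0, e1, p0, p1, (hA1 n).trans s1, (hA0 n).trans s2, (hA1 n).trans (hexp _ _ _ hr1),
    (hA0 n).trans (hexp _ _ _ hr2)⟩

theorem nonneg_of_mem_closure_convexHull_rectangles {r : ℝ × ℝ}
    (hr : r ∈ closure (convexHull ℝ (rectangles R N₀ N₁))) : 0 ≤ r.1 ∧ 0 ≤ r.2 := by
  have h : closure (convexHull ℝ (rectangles R N₀ N₁)) ⊆
      Set.Ici (0 : ℝ) ×ˢ Set.Ici (0 : ℝ) :=
    closure_minimal (convexHull_min (fun x hx => ⟨hx.1, hx.2.1⟩)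
      ((convex_Ici 0).prod (convex_Ici 0))) (isClosed_Ici.prod isClosed_Ici)
  exact h hr

theorem RatioBounded.eventually_exists_isGood (h : RatioBounded R K N₀ N₁) (hK : 0 < K)
    [Nonempty R] (hne : N₀.toLin ≠ N₁.toLin) {r : ℝ × ℝ}
    (hr : r ∈ closure (convexHull ℝ (rectangles R N₀ N₁))) {δ : ℝ} (hδ : 0 < δ) :
    ∀ᶠ n : ℕ in atTop, ∃ S : Strategy R A B, S.IsGood N₀ N₁ r δ n := by
  obtain ⟨r', hr', hdist⟩ := Metric.mem_closure_iff.1 hr (δ / 3) (by positivity)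
  have hd1 : |r.1 - r'.1| < δ / 3 := (le_max_left _ _).trans_lt hdist
  have hd2 : |r.2 - r'.2| < δ / 3 := (le_max_right _ _).trans_lt hdist
  have hnn := nonneg_of_mem_closure_convexHull_rectangles (subset_closure hr')
  -- A small admixture of a measurement that tells the channels apart makes both means positive.
  obtain ⟨ρ, m, y, hy⟩ := exists_outcomeProb_ne (R := R) hne
  have hg := h.relEnt_mem_rectangles (ρ, m)
  have g1 : 0 < relEnt N₁ N₀ (ρ, m) := h.symm.relEnt_pos hy.symm
  have g2 : 0 < relEnt N₀ N₁ (ρ, m) := h.relEnt_pos hy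
  set g : ℝ × ℝ := (relEnt N₁ N₀ (ρ, m), relEnt N₀ N₁ (ρ, m))
  obtain ⟨s, hs0, hs1, hs⟩ : ∃ s : ℝ, 0 < s ∧ s ≤ 1 ∧ s * (r'.1 + r'.2) ≤ δ / 3 := by
    have hpos : 0 < 1 + r'.1 + r'.2 := by linarith [hnn.1, hnn.2]
    refine ⟨min 1 (δ / 3 / (1 + r'.1 + r'.2)), by positivity, min_le_left _ _, ?_⟩
    calc _ ≤ δ / 3 / (1 + r'.1 + r'.2) * (1 + r'.1 + r'.2) := by
          refine mul_le_mul (min_le_right _ _) (by linarith) (by linarith [hnn.1, hnn.2])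
            (by positivity)
      _ = δ / 3 := div_mul_cancel₀ _ hpos.ne'
  have hp := (convex_convexHull ℝ (rectangles R N₀ N₁)) hr' (subset_convexHull ℝ _ hg)
    (by linarith : 0 ≤ 1 - s) hs0.le (by ring)
  obtain ⟨q, ν, hν1, hν2⟩ := h.exists_integral_relEnt_ge hK.le hp
  have hlow : ∀ x y z : ℝ, 0 ≤ x → 0 < y → s * x ≤ δ / 3 → (1 - s) * x + s * y ≤ z →
      0 < z ∧ x - δ / 3 < z := by
    intro x y z hx hy hsx hz
    have := mul_pos hs0 hy
    have := mul_nonneg (by linarith : 0 ≤ 1 - s) hx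
    constructor <;> nlinarith
  obtain ⟨a1, b1⟩ := hlow r'.1 _ _ hnn.1 g1 (by nlinarith [hnn.2]) hν1
  obtain ⟨a2, b2⟩ := hlow r'.2 _ _ hnn.2 g2 (by nlinarith [hnn.1]) hν2
  obtain ⟨t1, ht1, ht1'⟩ := exists_between (max_lt a1 b1)
  obtain ⟨t2, ht2, ht2'⟩ := exists_between (max_lt a2 b2)
  rw [max_lt_iff] at ht1 ht2
  refine (h.eventually_sprt_isGood hK ν (t := (t1, t2)) (r := r) hδ ht1.1 ht2.1 ht1' ht2'
    ?_ ?_).mono fun n hn => ⟨_, hn⟩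
  · linarith [(abs_lt.1 hd1).2]
  · linarith [(abs_lt.1 hd2).2]

/-- Every point of the closed convex hull is achieved by one sequence of strategies that satisfies
both constraints on the running time. -/
theorem RatioBounded.subset_regionE_inter_regionP (h : RatioBounded R K N₀ N₁) (hK : 0 < K)
    [Nonempty R] (hne : N₀.toLin ≠ N₁.toLin) {ε : ℝ} (hε : 0 < ε) :
    closure (convexHull ℝ (rectangles R N₀ N₁)) ⊆ regionE R N₀ N₁ ∩ regionP R ε N₀ N₁ := by
  intro r hr
  obtain ⟨hr1, hr2⟩ := nonneg_of_mem_closure_convexHull_rectangles hr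
  have hev := fun δ (hδ : 0 < δ) => h.eventually_exists_isGood hK hne hr hδ
  have : Nonempty (Strategy R A B) := ⟨(hev 1 one_pos).exists.choose_spec.choose⟩
  obtain ⟨S, hS⟩ := exists_seq_eventually_of_tolerance
    (p := fun δ n (S : Strategy R A B) => S.IsGood N₀ N₁ r δ n)
    (fun δ δ' n S hδ hS => hS.mono hδ) hev
  have hzero : ∀ u : ℕ → ℝ≥0∞, (∀ δ > 0, ∀ᶠ n in atTop, u n ≤ ENNReal.ofReal δ) →
      Tendsto u atTop (nhds 0) := by
    intro u hu
    refine ENNReal.tendsto_nhds_zero.2 fun e he => ?_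
    rcases eq_or_ne e ⊤ with rfl | he'
    · exact Eventually.of_forall fun _ => le_top
    · filter_upwards [hu e.toReal (ENNReal.toReal_pos he.ne' he')] with n hn
      rwa [ENNReal.ofReal_toReal he'] at hn
  have hexp : HasExponents N₀ N₁ S r :=
    ⟨⟨hzero _ fun δ hδ => (hS δ hδ).mono fun n hn => hn.acceptProb_fst,
      hzero _ fun δ hδ => (hS δ hδ).mono fun n hn => hn.acceptProb_snd⟩,
      coe_le_errorExponent_iff.2 fun δ hδ => (hS δ hδ).mono fun n hn => hn.exponent_fst,
      coe_le_errorExponent_iff.2 fun δ hδ => (hS δ hδ).mono fun n hn => hn.exponent_snd⟩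
  refine ⟨⟨hr1, hr2, S, hexp, ?_⟩, ⟨hr1, hr2, S, hexp, ?_⟩⟩
  · refine limsup_le_of_le (by isBoundedDefault) ((hS 1 one_pos).mono fun n hn => ?_)
    refine (EReal.sub_nonpos).2 ?_
    have hmax : max ((S n).expectedTime N₀) ((S n).expectedTime N₁) ≤ (n : ℝ≥0∞) :=
      max_le hn.expectedTime_fst hn.expectedTime_snd
    exact (EReal.coe_ennreal_le_coe_ennreal_iff.2 hmax).trans_eq (by norm_cast)
  · have hlim := hzero (fun n => max ((S n).tailProb N₀ n) ((S n).tailProb N₁ n)) fun δ hδ =>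
      (hS δ hδ).mono fun n hn => max_le hn.tailProb_fst hn.tailProb_snd
    rw [hlim.limsup_eq]
    exact ENNReal.ofReal_pos.2 hε

end Regions

end ChannelDisc

end

theorem theorem3 {R A B : Type*} [Fintype R] [Fintype A] [Fintype B]
    [DecidableEq R] [DecidableEq B] [Nonempty R] [Nonempty A] [Nonempty B]
    (N₀ N₁ : ChannelDisc.QChannel A B) (hne : N₀.toLin ≠ N₁.toLin)
    (hfin : max (ChannelDisc.channelMaxDiv R N₀ N₁) (ChannelDisc.channelMaxDiv R N₁ N₀) < ⊤)
    (ε : ℝ) (hε₀ : 0 < ε) (hε₁ : ε < 1) :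
    ChannelDisc.regionE R N₀ N₁ = ChannelDisc.regionP R ε N₀ N₁ ∧
      ChannelDisc.regionP R ε N₀ N₁ =
        closure (convexHull ℝ (ChannelDisc.rectangles R N₀ N₁)) := by
  obtain ⟨K, hK, h⟩ := ChannelDisc.exists_ratioBounded hfin
  have hach := h.subset_regionE_inter_regionP hK hne hε₀
  have hE : ChannelDisc.regionE R N₀ N₁ = closure (convexHull ℝ (ChannelDisc.rectangles R N₀ N₁)) :=
    (h.regionE_subset hK).antisymm fun _ hr => (hach hr).1
  have hP : ChannelDisc.regionP R ε N₀ N₁ =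
      closure (convexHull ℝ (ChannelDisc.rectangles R N₀ N₁)) :=
    (h.regionP_subset hK hε₁).antisymm fun _ hr => (hach hr).2
  exact ⟨hE.trans hP.symm, hP⟩
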